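/- Consider a network of finitely many queues. A fraction $r(j,i)\ge 0$ of the vehicles leaving queue $j$ joins queue $i$ after a travel time $\tau(j,i)>0$, where $\sum_i r(j,i)\le 1$; the remaining vehicles leave the network. Let $R=\{r(i,j)\}$, assume that every vehicle eventually leaves, i.e. $\sum_j (R^n)(i,j)\to 0$ as $n\to\infty$ for every $i$, and let $\bar\tau=\max_{i,j}\tau(i,j)$. Let the exogenous arrival rates $e(i)(t)\ge 0$ and the service rates $c(i)(t)\ge 0$ be periodic with the same period $T>0$ and integrable over a period, with averages $\bar e(i)=\frac1T\int_0^T e(i)(t)\,dt$ and $\bar c(i)=\frac1T\int_0^T c(i)(t)\,dt$. A trajectory consists of queue lengths $x(i)(t)$, $t\ge 0$, and locally integrable departure rates $b(i)(t)$, $t\ge-\bar\tau$, with $x(i)(0)\ge 0$ and $b(i)\ge 0$ a.e. on $[-\bar\tau,0]$, such that for every $i$ and $t\ge 0$ $$x(i)(t)=x(i)(0)+\int_0^t\Big[e(i)(s)+\sum_j b(j)(s-\tau(j,i))\,r(j,i)-b(i)(s)\Big]ds,$$ and, for almost every $t\ge0$, $b(i)(t)=c(i)(t)$ if $x(i)(t)>0$,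 $b(i)(t)\in[0,c(i)(t)]$ if $x(i)(t)=0$, and $b(i)(t)=0$ if $x(i)(t)<0$. Its state at time $t\ge0$ is $(x(t),\beta(t))$, where $\beta(t)$ is the departure history $s\mapsto b(t+s)$, $s\in[-\bar\tau,0]$; histories that agree almost everywhere are identified. Assume the stability condition: there is $\epsilon>0$ such that, componentwise, $\bar c>(I-R^{\mathsf T})^{-1}\bar e+\epsilon\mathbf 1$. Then there exists a unique state trajectory $(x^*,\beta^*)$ that is periodic with period $T$, i.e. $(x^*(t+T),\beta^*(t+T))=(x^*(t),\beta^*(t))$ for all $t\ge 0$. Every trajectory converges to it: for every trajectory $(x,\beta)$ and every queue $i$, as $t\to\infty$, $$|x(i)(t)-x^*(i)(t)|\to0\quad\text{and}\quad\int_{t-\bar\tau}^{t}|b(i)(s)-b^*(i)(s)|\,ds\to0 .$$ -/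

import Mathlib

open MeasureTheory Filter Topology Set

/-- A network of queues indexed by the finite set `ι`: a fraction `r j i` of the vehicles leaving
queue `j` travels along the link `(j, i)` and joins queue `i` after the travel time `τ j i`; the
fraction `1 - ∑ i, r j i` leaves the network. -/
structure QueueNetwork (ι : Type*) [Fintype ι] [DecidableEq ι] where
  /-- The routing matrix `R`. -/
  r : Matrix ι ι ℝ
  /-- The travel times. -/
  τ : ι → ι → ℝ
  r_nonneg : ∀ i j, 0 ≤ r i j
  r_sum_le_one : ∀ i, ∑ j, r i j ≤ 1
  /-- Every vehicle eventually leaves: the fraction of the vehicles departing from queue `i` that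
  are routed to at least `n` further queues tends to `0` as `n → ∞`. -/
  eventually_leave : ∀ i, Tendsto (fun n : ℕ => ∑ j, (r ^ n) i j) atTop (𝓝 0)
  τ_pos : ∀ i j, 0 < τ i j

/-- The average over one period, `(1 / T) ∫₀ᵀ f(i)(t) dt`, for every queue `i`. -/
noncomputable def periodAverage {ι : Type*} (T : ℝ) (f : ι → ℝ → ℝ) (i : ι) : ℝ :=
  (1 / T) * ∫ t in (0 : ℝ)..T, f i t

namespace QueueNetwork

variable {ι : Type*} [Fintype ι] [DecidableEq ι]

/-- The largest travel time. -/
noncomputable def maxDelay (N : QueueNetwork ι) : ℝ := ⨆ p : ι × ι, N.τ p.1 p.2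

/-- The rate at which vehicles join queue `i` at time `t`, from outside the network at rate `e`
and from the other queues with departure rates `b`. -/
noncomputable def arrivals (N : QueueNetwork ι) (e b : ι → ℝ → ℝ) (i : ι) (t : ℝ) : ℝ :=
  e i t + ∑ j, b j (t - N.τ j i) * N.r j i

/-- The stability condition `c̄ > (I - Rᵀ)⁻¹ ē + ε 𝟏`, for some `ε > 0`. -/
def Stable (N : QueueNetwork ι) (T : ℝ) (e c : ι → ℝ → ℝ) : Prop :=
  ∃ ε : ℝ, 0 < ε ∧ ∀ i,
    ((1 - N.r.transpose)⁻¹.mulVec (periodAverage T e)) i + ε < periodAverage T c i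

/-- The functions `x` (queue lengths, relevant at times `t ≥ 0`) and `b` (departure rates, relevant
at times `t ≥ -τ̄`, where `τ̄` is the largest travel time) form a trajectory of the network with
exogenous arrival rates `e` and service rates `c`. Rates are locally integrable functions, so the
differential equation is required in integrated form, and the pointwise conditions on rates are
required at almost every time. -/
structure IsTrajectory (N : QueueNetwork ι) (e c x b : ι → ℝ → ℝ) : Prop where
  /-- The initial queues are nonnegative. -/
  init_queue : ∀ i, 0 ≤ x i 0
  /-- The initial departure history is nonnegative. -/
  init_history : ∀ i, ∀ᵐ s, s ∈ Icc (-N.maxDelay) 0 → 0 ≤ b i s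
  /-- Departure rates are integrable over bounded time intervals. -/
  integrable : ∀ i t, IntegrableOn (b i) (Icc (-N.maxDelay) t)
  /-- `ẋ(i) = a(i) - b(i)`. -/
  dynamics : ∀ i t, 0 ≤ t → x i t = x i 0 + ∫ s in (0 : ℝ)..t, (N.arrivals e b i s - b i s)
  /-- A nonempty queue is served at the full service rate, an empty one at most at that rate. -/
  service : ∀ i, ∀ᵐ t, 0 ≤ t →
    (0 < x i t → b i t = c i t) ∧ (x i t = 0 → b i t ∈ Icc 0 (c i t)) ∧ (x i t < 0 → b i t = 0)

/-- The state at time `t` consists of the queue lengths `x(t)` and the departure history `β(t)`,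
which is the function `s ↦ b(t + s)` on `[-τ̄, 0]`. The state of `(x, b)` at time `t` is equal to the
state of `(x', b')` at time `t'`; histories, being rates, are equal when they agree almost
everywhere. -/
def SameState (N : QueueNetwork ι) (x b : ι → ℝ → ℝ) (t : ℝ) (x' b' : ι → ℝ → ℝ) (t' : ℝ) : Prop :=
  ∀ i, x i t = x' i t' ∧ ∀ᵐ s, s ∈ Icc (-N.maxDelay) 0 → b i (t + s) = b' i (t' + s)

/-- The state trajectory `(x, β)` is periodic with period `T`. -/
def IsPeriodicState (N : QueueNetwork ι) (T : ℝ) (x b : ι → ℝ → ℝ) : Prop :=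
  ∀ t, 0 ≤ t → N.SameState x b (t + T) x b t

/-- The state trajectory `(x, β)` converges to the state trajectory `(x', β')`: as `t → ∞`, the
differences of the queue lengths tend to `0`, and so do the differences of the departure histories
in `L¹[-τ̄, 0]`. -/
def ConvergesTo (N : QueueNetwork ι) (x b x' b' : ι → ℝ → ℝ) : Prop :=
  ∀ i, Tendsto (fun t => |x i t - x' i t|) atTop (𝓝 0) ∧
    Tendsto (fun t => ∫ s in (-N.maxDelay)..0, |b i (t + s) - b' i (t + s)|) atTop (𝓝 0)

end QueueNetwork

/-! The engine is an L¹ comparison of two trajectories driven by the same `e` and `c`. At a single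
queue the longer of the two is nonempty, hence served at the full rate, so its departure rate is at
least that of the other. Thus `|x - x'| + ∫ |b - b'|` is at most its initial value plus `∫ |a - a'|`
(`abs_queue_sub_add_integral_le`). The arrivals differ only through routed departures, so the
integrals `v i` of `|b i - b' i|` satisfy `v ≤ u + Rᵀ v`, with `u` fixed by the initial data. Since
`Rⁿ → 0`, `v ≤ (I - Rᵀ)⁻¹ u` uniformly in time (`le_inv_mulVec`).

Hence `b - b'` is integrable on the half-line: the histories merge and `x - x'` has a limit. A
nonzero limit would keep one queue eventually nonempty and served at rate `c`, but the same matrix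
bound, applied to cumulative departures, allows only the average rate `(I - Rᵀ)⁻¹ ē`, which is below
`c̄` (`not_eventually_pos`). So any two trajectories converge to each other, and periodic ones
coincide.

For existence, Skorokhod reflection solves one queue, and positive travel times let the network be
solved step by step. Comparing the resulting trajectory with its own shift by `T` makes the
increments of `b` over a period integrable, so `b (t + n T)` converges for almost every `t`.
Stability bounds `x (n T)` along a subsequence, and dominated convergence yields a limit trajectory,
which is periodic (`exists_periodic`). -/

/-! ### Absolutely continuous functions. -/

/-- A function whose increments are dominated by those of an absolutely continuous function is
absolutely continuous. -/
theorem AbsolutelyContinuousOnInterval.of_dist_le {f g : ℝ → ℝ} {a b : ℝ}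
    (hf : AbsolutelyContinuousOnInterval f a b)
    (hg : ∀ s ∈ uIcc a b, ∀ t ∈ uIcc a b, dist (g s) (g t) ≤ dist (f s) (f t)) :
    AbsolutelyContinuousOnInterval g a b := by
  refine squeeze_zero' (Eventually.of_forall fun E => Finset.sum_nonneg fun _ _ => dist_nonneg)
    ?_ hf
  filter_upwards [mem_inf_of_right (mem_principal_self _)] with E hE
  exact Finset.sum_le_sum fun i hi => hg _ (hE.1 i hi).1 _ (hE.1 i hi).2

/-- A function given as an integral on `[0, t]` is almost everywhere differentiable there. -/
theorem ae_hasDerivAt_of_eq_integral {f g : ℝ → ℝ} {t : ℝ}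
    (hg : IntervalIntegrable g volume 0 t)
    (hf : ∀ s ∈ Icc 0 t, f s = f 0 + ∫ u in (0 : ℝ)..s, g u) :
    ∀ᵐ s, s ∈ Ioo 0 t → HasDerivAt f (g s) s := by
  filter_upwards [hg.ae_hasDerivAt_integral] with s hs hst
  have h0 : (0 : ℝ) ≤ t := (hst.1.trans hst.2).le
  have h1 := hs (by rw [uIcc_of_le h0]; exact Ioo_subset_Icc_self hst) 0 left_mem_uIcc
  refine (h1.const_add (f 0)).congr_of_eventuallyEq ?_
  filter_upwards [Ioo_mem_nhds hst.1 hst.2] with u hu using hf u (Ioo_subset_Icc_self hu)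

theorem absolutelyContinuousOnInterval_of_eq_integral {f g : ℝ → ℝ} {t : ℝ} (ht : 0 ≤ t)
    (hg : IntervalIntegrable g volume 0 t)
    (hf : ∀ s ∈ Icc 0 t, f s = f 0 + ∫ u in (0 : ℝ)..s, g u) :
    AbsolutelyContinuousOnInterval f 0 t := by
  refine (hg.absolutelyContinuousOnInterval_intervalIntegral (c := 0) left_mem_uIcc).of_dist_le ?_
  rw [uIcc_of_le ht]
  intro s hs u hu
  rw [hf s hs, hf u hu, dist_add_left]

theorem ae_mem_Ioo_of_mem_Ioc (t : ℝ) : ∀ᵐ s : ℝ, s ∈ Ioc 0 t → s ∈ Ioo 0 t := by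
  filter_upwards [compl_mem_ae_iff.2 (measure_singleton t)] with s hs h
  exact ⟨h.1, lt_of_le_of_ne h.2 hs⟩

/-- A bound on the growth of the absolute value of an absolutely continuous function. -/
theorem abs_le_abs_add_integral {f g h : ℝ → ℝ} {t : ℝ} (ht : 0 ≤ t)
    (hg : IntervalIntegrable g volume 0 t) (hh : IntervalIntegrable h volume 0 t)
    (hf : ∀ s ∈ Icc 0 t, f s = f 0 + ∫ u in (0 : ℝ)..s, g u)
    (hgh : ∀ᵐ s, 0 ≤ s →
      (0 < f s → g s ≤ h s) ∧ (f s < 0 → -g s ≤ h s) ∧ (f s = 0 → g s = 0 → 0 ≤ h s)) :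
    |f t| ≤ |f 0| + ∫ s in (0 : ℝ)..t, h s := by
  have hac := absolutelyContinuousOnInterval_of_eq_integral ht hg hf
  have hac' : AbsolutelyContinuousOnInterval (fun s => |f s|) 0 t :=
    hac.of_dist_le fun s _ u _ => by
      simpa [Real.dist_eq] using abs_abs_sub_abs_le_abs_sub (f s) (f u)
  have hint := hac'.integral_deriv_eq_sub
  suffices (∫ s in (0 : ℝ)..t, deriv (fun s => |f s|) s) ≤ ∫ s in (0 : ℝ)..t, h s by
    linarith
  refine intervalIntegral.integral_mono_ae_restrict ht hac'.intervalIntegrable_deriv hh ?_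
  rw [Filter.EventuallyLE, ae_restrict_iff' measurableSet_Icc]
  have h0 : ∀ᵐ s : ℝ, s ≠ 0 := compl_mem_ae_iff.2 (measure_singleton 0)
  filter_upwards [hac'.ae_differentiableAt, ae_hasDerivAt_of_eq_integral hg hf, hgh,
    ae_mem_Ioo_of_mem_Ioc t, h0] with s hd hfd hs hmem hs0 hst
  have hst' : s ∈ Ioo 0 t := hmem ⟨lt_of_le_of_ne hst.1 (Ne.symm hs0), hst.2⟩
  have hfd := hfd hst'
  obtain ⟨hp, hn, hz⟩ := hs hst.1
  rcases lt_trichotomy (f s) 0 with hlt | heq | hgt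
  · have h1 : HasDerivAt (fun s => |f s|) (-1 * g s) s := (hasDerivAt_abs_neg hlt).comp s hfd
    rw [h1.deriv]; linarith [hn hlt]
  · have hd := hd (by rw [uIcc_of_le ht]; exact hst)
    -- A zero of `f` minimizes `|f|`, so the derivative of `|f|` vanishes there; as `f s = 0`, this
    -- forces `f' = 0` too, so `g s = 0` and the third alternative applies.
    have hmin : IsLocalMin (fun s => |f s|) s := Eventually.of_forall fun u => by simp [heq]
    rw [hmin.deriv_eq_zero]
    refine hz heq ?_
    have h1 := hd.hasDerivAt
    rw [hmin.deriv_eq_zero] at h1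
    have h2 : HasDerivAt f 0 s := by
      rw [hasDerivAt_iff_isLittleO] at h1 ⊢
      simp only [heq, abs_zero, sub_zero, smul_zero] at h1 ⊢
      exact h1.of_abs_left
    exact hfd.unique h2
  · have h1 : HasDerivAt (fun s => |f s|) (1 * g s) s := (hasDerivAt_abs_pos hgt).comp s hfd
    rw [h1.deriv]; linarith [hp hgt]

/-! ### The single queue -/

/-- The net input `∫₀ᵗ (a - c)` of a queue with arrival rate `a` and service rate `c`. -/
noncomputable def netInput (a c : ℝ → ℝ) (t : ℝ) : ℝ := ∫ s in (0 : ℝ)..t, (a s - c s)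

/-- The cumulative unused service up to time `t` of a queue that is empty at time `0`. -/
noncomputable def unusedService (a c : ℝ → ℝ) (t : ℝ) : ℝ :=
  sSup ((fun s => -netInput a c s) '' Icc 0 t)

/-- The length at time `t` of a queue that is empty at time `0`: the Skorokhod reflection of the
net input. -/
noncomputable def queueLength (a c : ℝ → ℝ) (t : ℝ) : ℝ := netInput a c t + unusedService a c t

open Classical in
/-- The departure rate of a queue that is empty at time `0`. -/
noncomputable def departureRate (a c : ℝ → ℝ) (t : ℝ) : ℝ :=
  if 0 < queueLength a c t then c t else min (a t) (c t)

section SingleQueue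

variable {a c : ℝ → ℝ}

theorem netInput_congr {a' : ℝ → ℝ} {t s : ℝ} (h : ∀ u ∈ Icc 0 t, a u = a' u) (hs : s ∈ Icc 0 t) :
    netInput a c s = netInput a' c s := by
  refine intervalIntegral.integral_congr fun u hu => ?_
  rw [uIcc_of_le hs.1] at hu
  simp only [h u ⟨hu.1, hu.2.trans hs.2⟩]

theorem queueLength_congr {a' : ℝ → ℝ} {t : ℝ} (ht : 0 ≤ t) (h : ∀ u ∈ Icc 0 t, a u = a' u) :
    queueLength a c t = queueLength a' c t := by
  have h1 : (fun s => -netInput a c s) '' Icc 0 t = (fun s => -netInput a' c s) '' Icc 0 t :=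
    image_congr fun s hs => by rw [netInput_congr h hs]
  rw [queueLength, queueLength, unusedService, unusedService, h1,
    netInput_congr h (right_mem_Icc.2 ht)]

/-- The departure rate at time `t` only depends on the arrivals up to time `t`. -/
theorem departureRate_congr {a' : ℝ → ℝ} {t : ℝ} (ht : 0 ≤ t) (h : ∀ u ∈ Icc 0 t, a u = a' u) :
    departureRate a c t = departureRate a' c t := by
  rw [departureRate, departureRate, queueLength_congr ht h, h t (right_mem_Icc.2 ht)]

@[simp] theorem netInput_zero : netInput a c 0 = 0 := by simp [netInput]

@[simp] theorem queueLength_zero : queueLength a c 0 = 0 := by simp [queueLength, unusedService]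

variable (ha : ∀ u v, IntervalIntegrable a volume u v) (hc : ∀ u v, IntervalIntegrable c volume u v)

include ha hc

theorem continuous_netInput : Continuous (netInput a c) :=
  intervalIntegral.continuous_primitive (fun u v => (ha u v).sub (hc u v)) 0

theorem bddAbove_neg_netInput (t : ℝ) : BddAbove ((fun s => -netInput a c s) '' Icc 0 t) :=
  isCompact_Icc.bddAbove_image (continuous_netInput ha hc).neg.continuousOn

theorem neg_netInput_le {s t : ℝ} (hs : s ∈ Icc 0 t) : -netInput a c s ≤ unusedService a c t :=
  le_csSup (bddAbove_neg_netInput ha hc t) (mem_image_of_mem _ hs)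

theorem queueLength_nonneg {t : ℝ} (ht : 0 ≤ t) : 0 ≤ queueLength a c t := by
  have := neg_netInput_le ha hc (right_mem_Icc.2 ht)
  rw [queueLength]; linarith

-- The value comes from `sSup ∅ = 0`; it makes `unusedService` monotone on all of `ℝ`, so that its
-- derivative is nonnegative without a restriction to `t ≥ 0`.
omit ha hc in
theorem unusedService_of_neg {t : ℝ} (ht : t < 0) : unusedService a c t = 0 := by
  simp [unusedService, Icc_eq_empty (not_le.2 ht)]

theorem unusedService_nonneg (t : ℝ) : 0 ≤ unusedService a c t := by
  rcases lt_or_ge t 0 with ht | ht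
  · rw [unusedService_of_neg ht]
  · simpa using neg_netInput_le ha hc (left_mem_Icc.2 ht)

theorem monotone_unusedService : Monotone (unusedService a c) := by
  intro s t hst
  rcases lt_or_ge s 0 with hs | hs
  · rw [unusedService_of_neg hs]; exact unusedService_nonneg ha hc t
  · exact csSup_le_csSup (bddAbove_neg_netInput ha hc t) ((nonempty_Icc.2 hs).image _)
      (image_mono (Icc_subset_Icc_right hst))

/-- A running maximum rises after `s` by no more than the function itself does. This is the source
of absolute continuity. -/
theorem unusedService_sub_le {s t : ℝ} (hs : 0 ≤ s) (hst : s ≤ t) :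
    unusedService a c t - unusedService a c s ≤ ∫ u in s..t, |a u - c u| := by
  have hi : ∀ u v, IntervalIntegrable (fun u => a u - c u) volume u v :=
    fun u v => (ha u v).sub (hc u v)
  rw [sub_le_iff_le_add]
  refine csSup_le ((nonempty_Icc.2 (hs.trans hst)).image _) ?_
  rintro _ ⟨u, hu, rfl⟩
  rcases le_total u s with hus | hsu
  · have h1 := neg_netInput_le ha hc (t := s) ⟨hu.1, hus⟩
    have h2 : 0 ≤ ∫ u in s..t, |a u - c u| :=
      intervalIntegral.integral_nonneg hst fun u _ => abs_nonneg _
    simp only; linarith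
  · have h1 := neg_netInput_le ha hc (right_mem_Icc.2 hs)
    have h2 : netInput a c u = netInput a c s + ∫ v in s..u, (a v - c v) :=
      (intervalIntegral.integral_add_adjacent_intervals (hi 0 s) (hi s u)).symm
    have h3 : |∫ v in s..u, (a v - c v)| ≤ ∫ v in s..u, |a v - c v| :=
      intervalIntegral.abs_integral_le_integral_abs hsu
    have h4 : ∫ v in s..u, |a v - c v| ≤ ∫ v in s..t, |a v - c v| :=
      intervalIntegral.integral_mono_interval le_rfl hsu hu.2
        (Eventually.of_forall fun _ => abs_nonneg _) (hi s t).abs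
    have h5 := neg_abs_le (∫ v in s..u, (a v - c v))
    simp only; linarith

theorem absolutelyContinuousOnInterval_unusedService {t : ℝ} (ht : 0 ≤ t) :
    AbsolutelyContinuousOnInterval (unusedService a c) 0 t := by
  have hi : ∀ u v, IntervalIntegrable (fun u => |a u - c u|) volume u v :=
    fun u v => ((ha u v).sub (hc u v)).abs
  refine ((hi 0 t).absolutelyContinuousOnInterval_intervalIntegral (c := 0)
    left_mem_uIcc).of_dist_le ?_
  rw [uIcc_of_le ht]
  have key : ∀ s ∈ Icc 0 t, ∀ u ∈ Icc 0 t, s ≤ u → |unusedService a c s - unusedService a c u| ≤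
      |(∫ v in (0 : ℝ)..s, |a v - c v|) - (∫ v in (0 : ℝ)..u, |a v - c v|)| := by
    intro s hs u _ hsu
    rw [abs_sub_comm, abs_of_nonneg (sub_nonneg.2 (monotone_unusedService ha hc hsu)),
      abs_sub_comm, intervalIntegral.integral_interval_sub_left (hi _ _) (hi _ _)]
    exact (unusedService_sub_le ha hc hs.1 hsu).trans (le_abs_self _)
  intro s hs u hu
  rw [Real.dist_eq, Real.dist_eq]
  rcases le_total s u with h | h
  · exact key s hs u hu h
  · rw [abs_sub_comm, abs_sub_comm (∫ v in (0 : ℝ)..s, |a v - c v|)]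
    exact key u hu s hs h

/-- Service is not wasted while the queue is nonempty. -/
theorem unusedService_eventually_eq {t : ℝ} (ht : 0 ≤ t) (hpos : 0 < queueLength a c t) :
    ∀ᶠ u in 𝓝[≥] t, unusedService a c u = unusedService a c t := by
  have h1 : -netInput a c t < unusedService a c t := by rw [queueLength] at hpos; linarith
  have h2 : ∀ᶠ u in 𝓝 t, -netInput a c u < unusedService a c t :=
    (continuous_netInput ha hc).neg.continuousAt.eventually_lt continuousAt_const h1
  obtain ⟨l, u, htlu, hlu⟩ := mem_nhds_iff_exists_Ioo_subset.1 h2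
  filter_upwards [Ico_mem_nhdsGE htlu.2] with v hv
  refine le_antisymm (csSup_le ((nonempty_Icc.2 (ht.trans hv.1)).image _) ?_)
    (monotone_unusedService ha hc hv.1)
  rintro _ ⟨w, hw, rfl⟩
  rcases le_total w t with hwt | htw
  · exact neg_netInput_le ha hc ⟨hw.1, hwt⟩
  · exact (hlu ⟨htlu.1.trans_le htw, hw.2.trans_lt hv.2⟩ :
      -netInput a c w < unusedService a c t).le

/-- At an empty queue the length is minimal, so `a - c + L' = 0` with `L` the unused service; `L' ≥
0` gives `a ≤ c` and departures at rate `a`. At a nonempty queue `L` is constant just to the right,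
so `L' = 0` and departures occur at rate `c`. -/
theorem ae_deriv_queueLength {T : ℝ} (hT : 0 ≤ T) :
    ∀ᵐ t, t ∈ Ioo 0 T →
      HasDerivAt (queueLength a c) (a t - departureRate a c t) t ∧
        (queueLength a c t = 0 → a t ≤ c t) := by
  have hi : IntervalIntegrable (fun u => a u - c u) volume 0 T := (ha 0 T).sub (hc 0 T)
  filter_upwards [ae_hasDerivAt_of_eq_integral (f := netInput a c) hi
    (fun s _ => by simp [netInput]),
    (absolutelyContinuousOnInterval_unusedService ha hc hT).ae_differentiableAt] with t hF hL ht
  have hF := hF ht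
  have hL := (hL (by rw [uIcc_of_le hT]; exact Ioo_subset_Icc_self ht)).hasDerivAt
  have hQ : HasDerivAt (queueLength a c) (a t - c t + deriv (unusedService a c) t) t := hF.add hL
  have hnn : 0 ≤ deriv (unusedService a c) t := (monotone_unusedService ha hc).deriv_nonneg
  rcases (queueLength_nonneg ha hc ht.1.le).eq_or_lt with h0 | hpos
  · have hmin : IsLocalMin (queueLength a c) t := by
      filter_upwards [Ioi_mem_nhds ht.1] with u hu
      rw [← h0]; exact queueLength_nonneg ha hc (le_of_lt hu)
    have hz := hmin.hasDerivAt_eq_zero hQ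
    have hle : a t ≤ c t := by linarith
    refine ⟨?_, fun _ => hle⟩
    rw [departureRate, if_neg (by rw [← h0]; exact lt_irrefl _), min_eq_left hle, sub_self,
      ← hz]
    exact hQ
  · have hz : deriv (unusedService a c) t = 0 := by
      have h1 := hL.hasDerivWithinAt (s := Ici t)
      have h2 : HasDerivWithinAt (unusedService a c) 0 (Ici t) t :=
        (hasDerivWithinAt_const t (Ici t) (unusedService a c t)).congr_of_eventuallyEq
          (unusedService_eventually_eq ha hc ht.1.le hpos) rfl
      exact (uniqueDiffWithinAt_Ici t).eq_deriv _ h1 h2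
    rw [departureRate, if_pos hpos]
    refine ⟨?_, fun h => absurd h hpos.ne'⟩
    simpa [hz] using hQ

theorem absolutelyContinuousOnInterval_queueLength {t : ℝ} (ht : 0 ≤ t) :
    AbsolutelyContinuousOnInterval (queueLength a c) 0 t :=
  (absolutelyContinuousOnInterval_of_eq_integral ht ((ha 0 t).sub (hc 0 t))
    (f := netInput a c) (fun s _ => by simp [netInput])).add
    (absolutelyContinuousOnInterval_unusedService ha hc ht)

theorem ae_departureRate_eq {T : ℝ} (hT : 0 ≤ T) :
    ∀ᵐ t, t ∈ Ioc 0 T → a t - departureRate a c t = deriv (queueLength a c) t := by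
  filter_upwards [ae_deriv_queueLength ha hc hT, ae_mem_Ioo_of_mem_Ioc T] with t ht hmem h
  exact (ht (hmem h)).1.deriv.symm

/-- Almost everywhere the rate is `a` minus the derivative of an absolutely continuous function,
which avoids treating the case distinction in its definition. -/
theorem intervalIntegrable_departureRate {t : ℝ} (ht : 0 ≤ t) :
    IntervalIntegrable (departureRate a c) volume 0 t := by
  have h1 := (ha 0 t).sub (absolutelyContinuousOnInterval_queueLength ha hc ht).intervalIntegrable_deriv
  refine h1.congr_ae ?_
  rw [uIoc_of_le ht, Filter.EventuallyEq, ae_restrict_iff' measurableSet_Ioc]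
  filter_upwards [ae_departureRate_eq ha hc ht] with s hs hst
  have := hs hst
  linarith

theorem queueLength_eq_integral {t : ℝ} (ht : 0 ≤ t) :
    queueLength a c t = ∫ s in (0 : ℝ)..t, (a s - departureRate a c s) := by
  have h1 := (absolutelyContinuousOnInterval_queueLength ha hc ht).integral_deriv_eq_sub
  rw [queueLength_zero, sub_zero] at h1
  rw [← h1]
  refine intervalIntegral.integral_congr_ae ?_
  filter_upwards [ae_departureRate_eq ha hc ht] with s hs hst
  rw [uIoc_of_le ht] at hst
  exact (hs hst).symm

end SingleQueue

theorem departureRate_nonneg {a c : ℝ → ℝ} (ha : ∀ t, 0 ≤ a t) (hc : ∀ t, 0 ≤ c t) (t : ℝ) :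
    0 ≤ departureRate a c t := by
  rw [departureRate]
  split_ifs
  · exact hc t
  · exact le_min (ha t) (hc t)

/-! ### Existence of a trajectory, by iteration over the smallest travel time. -/

namespace QueueNetwork

variable {ι : Type*} [Fintype ι] [DecidableEq ι] (N : QueueNetwork ι)

theorem le_maxDelay (i j : ι) : N.τ i j ≤ N.maxDelay :=
  le_ciSup (f := fun p : ι × ι => N.τ p.1 p.2) (Finite.bddAbove_range _) (i, j)

theorem maxDelay_nonneg : 0 ≤ N.maxDelay :=
  Real.iSup_nonneg fun p => (N.τ_pos p.1 p.2).le

theorem exists_minDelay : ∃ δ : ℝ, 0 < δ ∧ ∀ i j, δ ≤ N.τ i j := by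
  rcases isEmpty_or_nonempty ι with h | h
  · exact ⟨1, one_pos, fun i => isEmptyElim i⟩
  · obtain ⟨p, hp⟩ := Finite.exists_min (fun p : ι × ι => N.τ p.1 p.2)
    exact ⟨N.τ p.1 p.2, N.τ_pos _ _, fun i j => hp (i, j)⟩

theorem arrivals_nonneg {e b : ι → ℝ → ℝ} (he : ∀ i t, 0 ≤ e i t) (hb : ∀ i t, 0 ≤ b i t)
    (i : ι) (t : ℝ) : 0 ≤ N.arrivals e b i t :=
  add_nonneg (he i t) (Finset.sum_nonneg fun j _ => mul_nonneg (hb j _) (N.r_nonneg j i))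

theorem arrivals_congr {e b b' : ι → ℝ → ℝ} {i : ι} {t : ℝ}
    (h : ∀ j, b j (t - N.τ j i) = b' j (t - N.τ j i)) :
    N.arrivals e b i t = N.arrivals e b' i t := by
  simp only [arrivals, h]

theorem intervalIntegrable_arrivals {e b : ι → ℝ → ℝ} {i : ι} {u v : ℝ}
    (he : IntervalIntegrable (e i) volume u v)
    (hb : ∀ j, IntervalIntegrable (b j) volume (u - N.τ j i) (v - N.τ j i)) :
    IntervalIntegrable (N.arrivals e b i) volume u v := by
  refine he.add ?_
  have h := IntervalIntegrable.sum (μ := volume) (a := u) (b := v) Finset.univ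
    (f := fun j t => b j (t - N.τ j i) * N.r j i) fun j _ => by
      have := (hb j).comp_sub_right (N.τ j i)
      simp only [sub_add_cancel] at this
      exact this.mul_const _
  exact h.congr fun t _ => by simp

/-- Departure rates, starting from an empty network, obtained by feeding the departure rates `b`
into the queues once. -/
noncomputable def stepDepartures (e c b : ι → ℝ → ℝ) (i : ι) (t : ℝ) : ℝ :=
  if 0 ≤ t then departureRate (N.arrivals e b i) (c i) t else 0

/-- The iterates of `stepDepartures`, starting from `0`. -/
noncomputable def iterDepartures (e c : ι → ℝ → ℝ) (n : ℕ) : ι → ℝ → ℝ :=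
  (N.stepDepartures e c)^[n] 0

theorem iterDepartures_succ (e c : ι → ℝ → ℝ) (n : ℕ) :
    N.iterDepartures e c (n + 1) = N.stepDepartures e c (N.iterDepartures e c n) :=
  Function.iterate_succ_apply' _ _ _

/-- Vehicles take at least `δ` to reach the next queue, so each feeding determines the departures
for a further time `δ`. The iterates therefore become stationary on every bounded interval. -/
theorem stepDepartures_congr {e c b b' : ι → ℝ → ℝ} {δ t : ℝ} (hδ : ∀ i j, δ ≤ N.τ i j)
    (h : ∀ j s, s ≤ t - δ → b j s = b' j s) (i : ι) :
    N.stepDepartures e c b i t = N.stepDepartures e c b' i t := by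
  simp only [stepDepartures]
  split_ifs with ht
  · refine departureRate_congr ht fun u hu => N.arrivals_congr fun j => h j _ ?_
    linarith [hδ j i, hu.2]
  · rfl

theorem iterDepartures_succ_eq {e c : ι → ℝ → ℝ} {δ : ℝ} (hδ : ∀ i j, δ ≤ N.τ i j) (n : ℕ) :
    ∀ i t, t < n * δ → N.iterDepartures e c (n + 1) i t = N.iterDepartures e c n i t := by
  induction n with
  | zero =>
    intro i t ht
    simp only [Nat.cast_zero, zero_mul] at ht
    rw [iterDepartures_succ, stepDepartures, if_neg (not_le.2 ht)]
    rfl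
  | succ n ih =>
    intro i t ht
    push_cast at ht
    rw [iterDepartures_succ, iterDepartures_succ]
    exact N.stepDepartures_congr hδ (fun j s hs => by
      rw [← iterDepartures_succ]; exact ih j s (by linarith)) i

theorem iterDepartures_eq_of_le {e c : ι → ℝ → ℝ} {δ : ℝ} (h0 : 0 < δ) (hδ : ∀ i j, δ ≤ N.τ i j)
    {m n : ℕ} (hmn : m ≤ n) {i : ι} {t : ℝ} (ht : t < m * δ) :
    N.iterDepartures e c n i t = N.iterDepartures e c m i t := by
  induction n, hmn using Nat.le_induction with
  | base => rfl
  | succ n hmn ih =>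
    rw [← ih]
    refine N.iterDepartures_succ_eq hδ n i t (ht.trans_le ?_)
    gcongr

theorem iterDepartures_nonneg {e c : ι → ℝ → ℝ} (he : ∀ i t, 0 ≤ e i t) (hc : ∀ i t, 0 ≤ c i t)
    (n : ℕ) (i : ι) (t : ℝ) : 0 ≤ N.iterDepartures e c n i t := by
  induction n generalizing i t with
  | zero => exact le_rfl
  | succ n ih =>
    rw [iterDepartures_succ, stepDepartures]
    split_ifs
    · exact departureRate_nonneg (N.arrivals_nonneg he ih i) (hc i) t
    · exact le_rfl

theorem intervalIntegrable_stepDepartures {e c b : ι → ℝ → ℝ}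
    (he : ∀ i u v, IntervalIntegrable (e i) volume u v)
    (hc : ∀ i u v, IntervalIntegrable (c i) volume u v)
    (hb : ∀ i u v, IntervalIntegrable (b i) volume u v) (i : ι) (u v : ℝ) :
    IntervalIntegrable (N.stepDepartures e c b i) volume u v := by
  suffices h : ∀ v, IntervalIntegrable (N.stepDepartures e c b i) volume 0 v from
    (h u).symm.trans (h v)
  intro v
  rcases le_total 0 v with hv | hv
  · refine (intervalIntegrable_departureRate (fun u v => N.intervalIntegrable_arrivals (he i u v)
      fun j => hb j _ _) (hc i) hv).congr fun s hs => ?_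
    rw [uIoc_of_le hv] at hs
    rw [stepDepartures, if_pos hs.1.le]
  · refine (intervalIntegrable_const (c := (0 : ℝ))).congr_ae ?_
    rw [uIoc_of_ge hv, Filter.EventuallyEq, ae_restrict_iff' measurableSet_Ioc]
    have h0 : ∀ᵐ s : ℝ, s ≠ 0 := compl_mem_ae_iff.2 (measure_singleton 0)
    filter_upwards [h0] with s hs0 hs
    rw [stepDepartures, if_neg (not_le.2 (lt_of_le_of_ne hs.2 hs0))]

theorem intervalIntegrable_iterDepartures {e c : ι → ℝ → ℝ}
    (he : ∀ i u v, IntervalIntegrable (e i) volume u v)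
    (hc : ∀ i u v, IntervalIntegrable (c i) volume u v) (n : ℕ) (i : ι) (u v : ℝ) :
    IntervalIntegrable (N.iterDepartures e c n i) volume u v := by
  induction n generalizing i u v with
  | zero => exact intervalIntegrable_const (c := (0 : ℝ))
  | succ n ih => rw [iterDepartures_succ]; exact N.intervalIntegrable_stepDepartures he hc ih i u v

/-- Departure rates that reproduce themselves when fed into the initially empty queues. -/
theorem exists_stepDepartures_eq_self {e c : ι → ℝ → ℝ} (he_nonneg : ∀ i t, 0 ≤ e i t)
    (hc_nonneg : ∀ i t, 0 ≤ c i t) (he : ∀ i u v, IntervalIntegrable (e i) volume u v)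
    (hc : ∀ i u v, IntervalIntegrable (c i) volume u v) :
    ∃ b : ι → ℝ → ℝ, N.stepDepartures e c b = b ∧ (∀ i t, 0 ≤ b i t) ∧
      ∀ i u v, IntervalIntegrable (b i) volume u v := by
  obtain ⟨δ, h0, hδ⟩ := N.exists_minDelay
  have hm : ∀ t : ℝ, ∃ n : ℕ, t < n * δ := fun t => by
    obtain ⟨n, hn⟩ := exists_nat_gt (t / δ)
    exact ⟨n, (div_lt_iff₀ h0).1 hn⟩
  choose m hm using hm
  set b : ι → ℝ → ℝ := fun i t => N.iterDepartures e c (m t) i t with hb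
  have key : ∀ (n : ℕ) i t, t < n * δ → N.iterDepartures e c n i t = b i t := by
    intro n i t ht
    rcases le_total n (m t) with h | h
    · exact (N.iterDepartures_eq_of_le h0 hδ h ht).symm
    · exact N.iterDepartures_eq_of_le h0 hδ h (hm t)
  refine ⟨b, ?_, fun i t => N.iterDepartures_nonneg he_nonneg hc_nonneg _ i t, fun i u v => ?_⟩
  · ext i t
    -- The iterate with index `m t + 1` is used because a successor unfolds into one step applied to
    -- the iterate `m t`.
    have hs : t < ((m t + 1 : ℕ) : ℝ) * δ := by push_cast; linarith [hm t]
    rw [← key _ i t hs, iterDepartures_succ]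
    exact N.stepDepartures_congr hδ (fun j s hs => (key _ j s (by linarith [hm t])).symm) i
  · refine (N.intervalIntegrable_iterDepartures he hc (m (max u v)) i u v).congr fun s hs =>
      key _ i s (hs.2.trans_lt (hm _))

/-- The trajectory that starts from an empty network. -/
theorem exists_isTrajectory {e c : ι → ℝ → ℝ} (he_nonneg : ∀ i t, 0 ≤ e i t)
    (hc_nonneg : ∀ i t, 0 ≤ c i t) (he : ∀ i u v, IntervalIntegrable (e i) volume u v)
    (hc : ∀ i u v, IntervalIntegrable (c i) volume u v) :
    ∃ x b, N.IsTrajectory e c x b := by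
  obtain ⟨b, hb, hnn, hint⟩ := N.exists_stepDepartures_eq_self he_nonneg hc_nonneg he hc
  have hbt : ∀ i t, 0 ≤ t → b i t = departureRate (N.arrivals e b i) (c i) t := fun i t ht => by
    conv_lhs => rw [← hb]
    rw [stepDepartures, if_pos ht]
  have ha : ∀ i u v, IntervalIntegrable (N.arrivals e b i) volume u v := fun i u v =>
    N.intervalIntegrable_arrivals (he i u v) fun j => hint j _ _
  refine ⟨fun i => queueLength (N.arrivals e b i) (c i), b, ?_, ?_, ?_, ?_, ?_⟩
  · intro i; simp
  · exact fun i => Eventually.of_forall fun s _ => hnn i s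
  · intro i t
    rcases le_total (-N.maxDelay) t with h | h
    · exact (intervalIntegrable_iff_integrableOn_Icc_of_le h).1 (hint i _ _)
    · exact ((intervalIntegrable_iff_integrableOn_Icc_of_le h).1 (hint i _ _)).mono_set
        (by
          rcases h.eq_or_lt with rfl | h
          · exact subset_rfl
          · rw [Icc_eq_empty (not_le.2 h)]; exact empty_subset _)
  · intro i t ht
    rw [queueLength_zero, zero_add, queueLength_eq_integral (ha i) (hc i) ht]
    refine intervalIntegral.integral_congr fun s hs => ?_
    rw [uIcc_of_le ht] at hs
    simp only [hbt i s hs.1]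
  · refine fun i => Eventually.of_forall fun t ht => ⟨fun hx => ?_, fun hx => ?_, fun hx => ?_⟩
    · rw [hbt i t ht, departureRate, if_pos hx]
    -- The `min` in `departureRate` gives the upper bound at every time, not only where `a ≤ c` is
    -- known.
    · refine ⟨hnn i t, ?_⟩
      rw [hbt i t ht, departureRate, if_neg (by rw [hx]; exact lt_irrefl _)]
      exact min_le_right _ _
    · exact absurd (queueLength_nonneg (ha i) (hc i) ht) (not_le.2 hx)

end QueueNetwork

/-! ### Translations in time. -/

theorem ae_add_right {P : ℝ → Prop} (h : ∀ᵐ s, P s) (r : ℝ) : ∀ᵐ s, P (s + r) :=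
  (measurePreserving_add_right volume r).quasiMeasurePreserving.ae h

theorem ae_sub_right {P : ℝ → Prop} (h : ∀ᵐ s, P s) (r : ℝ) : ∀ᵐ s, P (s - r) := by
  simpa only [sub_eq_add_neg] using ae_add_right h (-r)

/-- The shifted window `[-r, t - r]` lies in `[-D, t]`. This removes the travel times from all
estimates, at the price of including the initial history. -/
theorem integral_comp_sub_le {f : ℝ → ℝ} {D r t : ℝ} (hr : 0 ≤ r) (hrD : r ≤ D) (ht : 0 ≤ t)
    (hf : IntervalIntegrable f volume (-D) t) (h0 : ∀ᵐ s, -D ≤ s → 0 ≤ f s) :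
    ∫ s in (0 : ℝ)..t, f (s - r) ≤ ∫ s in (-D)..t, f s := by
  rw [intervalIntegral.integral_comp_sub_right]
  refine intervalIntegral.integral_mono_interval (by linarith) (by linarith) (by linarith) ?_ hf
  rw [Filter.EventuallyLE, ae_restrict_iff' measurableSet_Ioc]
  filter_upwards [h0] with s hs hst using hs hst.1.le

namespace QueueNetwork

variable {ι : Type*} [Fintype ι] [DecidableEq ι] {N : QueueNetwork ι}

/-! ### The traffic equation. -/

section Matrix

open Matrix

theorem tendsto_pow_entry (N : QueueNetwork ι) (i j : ι) :
    Tendsto (fun n : ℕ => (N.r ^ n) i j) atTop (𝓝 0) := by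
  have hnn : ∀ (n : ℕ) i j, 0 ≤ (N.r ^ n) i j := by
    intro n
    induction n with
    | zero => intro i j; rw [pow_zero, Matrix.one_apply]; split_ifs <;> norm_num
    | succ n ih =>
      intro i j
      rw [pow_succ, Matrix.mul_apply]
      exact Finset.sum_nonneg fun k _ => mul_nonneg (ih i k) (N.r_nonneg k j)
  exact squeeze_zero (fun n => hnn n i j)
    (fun n => Finset.single_le_sum (fun k _ => hnn n i k) (Finset.mem_univ j))
    (N.eventually_leave i)

theorem tendsto_transpose_pow_mulVec (N : QueueNetwork ι) (v : ι → ℝ) (i : ι) :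
    Tendsto (fun n : ℕ => ((N.rᵀ ^ n) *ᵥ v) i) atTop (𝓝 0) := by
  have h : Tendsto (fun n : ℕ => ∑ j, (N.r ^ n) j i * v j) atTop (𝓝 (∑ j, 0 * v j)) :=
    tendsto_finsetSum _ fun j _ => (N.tendsto_pow_entry j i).mul_const _
  simpa [Matrix.mulVec, dotProduct, ← Matrix.transpose_pow] using h

/-- A kernel vector is fixed by every power of `Rᵀ`, and these powers tend to `0`. -/
theorem isUnit_det_one_sub (N : QueueNetwork ι) : IsUnit (1 - N.rᵀ).det := by
  rw [isUnit_iff_ne_zero]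
  intro h
  obtain ⟨v, hv, hv0⟩ := Matrix.exists_mulVec_eq_zero_iff.2 h
  have h1 : N.rᵀ *ᵥ v = v := by
    rw [Matrix.sub_mulVec, Matrix.one_mulVec, sub_eq_zero] at hv0
    exact hv0.symm
  have h2 : ∀ n : ℕ, (N.rᵀ ^ n) *ᵥ v = v := by
    intro n
    induction n with
    | zero => simp
    | succ n ih => rw [pow_succ, ← Matrix.mulVec_mulVec, h1, ih]
  refine hv (funext fun i => ?_)
  have h3 := N.tendsto_transpose_pow_mulVec v i
  simp only [h2] at h3
  exact tendsto_nhds_unique tendsto_const_nhds h3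

/-- Solutions of the traffic inequality are bounded by the solution of the traffic equation. -/
theorem le_inv_mulVec (N : QueueNetwork ι) {u v : ι → ℝ}
    (h : ∀ i, v i ≤ u i + ∑ j, v j * N.r j i) (i : ι) : v i ≤ ((1 - N.rᵀ)⁻¹ *ᵥ u) i := by
  set y := (1 - N.rᵀ)⁻¹ *ᵥ u with hy
  have h1 : y = u + N.rᵀ *ᵥ y := by
    have : (1 - N.rᵀ) *ᵥ y = u := by
      rw [hy, Matrix.mulVec_mulVec, Matrix.mul_nonsing_inv _ N.isUnit_det_one_sub,
        Matrix.one_mulVec]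
    rw [Matrix.sub_mulVec, Matrix.one_mulVec] at this
    rw [← this]; abel
  have hmono : ∀ {w z : ι → ℝ}, (∀ i, w i ≤ z i) → ∀ i, (N.rᵀ *ᵥ w) i ≤ (N.rᵀ *ᵥ z) i :=
    fun hwz i => Finset.sum_le_sum fun j _ => mul_le_mul_of_nonneg_left (hwz j) (N.r_nonneg j i)
  -- The excess `w = v - y` satisfies `w ≤ Rᵀ w`; as `Rᵀ` preserves order, `w ≤ (Rᵀ)ⁿ w → 0`.
  have h2 : ∀ i, (v - y) i ≤ (N.rᵀ *ᵥ (v - y)) i := by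
    intro i
    have h3 := h i
    have h4 := congrFun h1 i
    have h5 : (N.rᵀ *ᵥ v) i = ∑ j, v j * N.r j i := by
      simp [Matrix.mulVec, dotProduct, mul_comm]
    rw [Matrix.mulVec_sub, Pi.sub_apply, Pi.sub_apply, h5]
    rw [Pi.add_apply] at h4
    linarith
  have h3 : ∀ (n : ℕ) i, (v - y) i ≤ ((N.rᵀ ^ n) *ᵥ (v - y)) i := by
    intro n
    induction n with
    | zero => simp
    | succ n ih =>
      intro i
      rw [pow_succ', ← Matrix.mulVec_mulVec]
      exact (h2 i).trans (hmono ih i)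
  exact sub_nonpos.1 (ge_of_tendsto' (N.tendsto_transpose_pow_mulVec (v - y) i) fun n => h3 n i)

end Matrix

/-! ### Basic properties of trajectories. -/

namespace IsTrajectory

variable {e c x b x' b' : ι → ℝ → ℝ}

theorem intervalIntegrable (h : N.IsTrajectory e c x b) (i : ι) {u v : ℝ} (hu : -N.maxDelay ≤ u)
    (hv : -N.maxDelay ≤ v) : IntervalIntegrable (b i) volume u v := by
  have key : ∀ w, -N.maxDelay ≤ w → IntervalIntegrable (b i) volume (-N.maxDelay) w := fun w hw =>
    (intervalIntegrable_iff_integrableOn_Icc_of_le hw).2 (h.integrable i w)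
  exact (key u hu).symm.trans (key v hv)

theorem intervalIntegrable_comp_sub (h : N.IsTrajectory e c x b) (i j : ι) {u v : ℝ}
    (hu : 0 ≤ u) (hv : 0 ≤ v) :
    IntervalIntegrable (fun s => b j (s - N.τ j i)) volume u v := by
  have h1 := N.le_maxDelay j i
  have := (h.intervalIntegrable j (u := u - N.τ j i) (v := v - N.τ j i) (by linarith)
    (by linarith)).comp_sub_right (N.τ j i)
  simpa only [sub_add_cancel] using this

theorem intervalIntegrable_arrivals (h : N.IsTrajectory e c x b)
    (he : ∀ i u v, IntervalIntegrable (e i) volume u v) (i : ι) {u v : ℝ} (hu : 0 ≤ u)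
    (hv : 0 ≤ v) : IntervalIntegrable (N.arrivals e b i) volume u v :=
  N.intervalIntegrable_arrivals (he i u v) fun j =>
    h.intervalIntegrable j (by linarith [N.le_maxDelay j i]) (by linarith [N.le_maxDelay j i])

theorem ae_nonneg (h : N.IsTrajectory e c x b) (hc : ∀ i t, 0 ≤ c i t) (i : ι) :
    ∀ᵐ s, -N.maxDelay ≤ s → 0 ≤ b i s := by
  filter_upwards [h.init_history i, h.service i] with s h1 h2 hs
  rcases le_total s 0 with h0 | h0
  · exact h1 ⟨hs, h0⟩
  · obtain ⟨hp, hz, hn⟩ := h2 h0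
    rcases lt_trichotomy (x i s) 0 with hx | hx | hx
    · rw [hn hx]
    · exact (hz hx).1
    · rw [hp hx]; exact hc i s

theorem ae_arrivals_nonneg (h : N.IsTrajectory e c x b) (he : ∀ i t, 0 ≤ e i t)
    (hc : ∀ i t, 0 ≤ c i t) (i : ι) : ∀ᵐ s, 0 ≤ s → 0 ≤ N.arrivals e b i s := by
  filter_upwards [ae_all_iff.2 fun j => ae_sub_right (h.ae_nonneg hc j) (N.τ j i)] with s hs h0
  exact add_nonneg (he i s) (Finset.sum_nonneg fun j _ =>
    mul_nonneg (hs j (by linarith [N.le_maxDelay j i])) (N.r_nonneg j i))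

/-- With the net rate `g` as its own bound, `abs_le_abs_add_integral` gives `|x t| ≤ x 0 + ∫ g = x
t`. The bound is admissible because a negative queue has no departures, so there `g ≥ 0`. -/
theorem queue_nonneg (h : N.IsTrajectory e c x b) (he0 : ∀ i t, 0 ≤ e i t)
    (hc0 : ∀ i t, 0 ≤ c i t) (he : ∀ i u v, IntervalIntegrable (e i) volume u v)
    (i : ι) {t : ℝ} (ht : 0 ≤ t) : 0 ≤ x i t := by
  have hi : IntervalIntegrable (fun s => N.arrivals e b i s - b i s) volume 0 t :=
    (h.intervalIntegrable_arrivals he i le_rfl ht).sub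
      (h.intervalIntegrable i (by linarith [N.maxDelay_nonneg]) (by linarith [N.maxDelay_nonneg]))
  have key := abs_le_abs_add_integral ht hi hi (fun s hs => h.dynamics i s hs.1) (by
    filter_upwards [h.ae_arrivals_nonneg he0 hc0 i, h.service i] with s ha hs h0
    refine ⟨fun _ => le_rfl, fun hx => ?_, fun _ hg => hg.ge⟩
    rw [(hs h0).2.2 hx]
    linarith [ha h0])
  rw [abs_of_nonneg (h.init_queue i), ← h.dynamics i t ht] at key
  exact (abs_nonneg _).trans key

theorem ae_le_service (h : N.IsTrajectory e c x b) (he0 : ∀ i t, 0 ≤ e i t)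
    (hc0 : ∀ i t, 0 ≤ c i t) (he : ∀ i u v, IntervalIntegrable (e i) volume u v) (i : ι) :
    ∀ᵐ s, 0 ≤ s → b i s ≤ c i s := by
  filter_upwards [h.service i] with s hs h0
  obtain ⟨hp, hz, -⟩ := hs h0
  rcases (h.queue_nonneg he0 hc0 he i h0).eq_or_lt with hx | hx
  · exact (hz hx.symm).2
  · exact (hp hx).le

theorem queue_eq_add (h : N.IsTrajectory e c x b)
    (he : ∀ i u v, IntervalIntegrable (e i) volume u v) (i : ι) {s t : ℝ} (hs : 0 ≤ s)
    (ht : 0 ≤ t) : x i t = x i s + ∫ u in s..t, (N.arrivals e b i u - b i u) := by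
  have hi : ∀ v, 0 ≤ v → IntervalIntegrable (fun s => N.arrivals e b i s - b i s) volume 0 v :=
    fun v hv => (h.intervalIntegrable_arrivals he i le_rfl hv).sub
      (h.intervalIntegrable i (by linarith [N.maxDelay_nonneg]) (by linarith [N.maxDelay_nonneg]))
  rw [h.dynamics i t ht, h.dynamics i s hs, ← intervalIntegral.integral_interval_sub_left
    (hi t ht) (hi s hs)]
  ring

/-- The trajectory of the network observed from time `r` on. -/
theorem shift (h : N.IsTrajectory e c x b) (he0 : ∀ i t, 0 ≤ e i t) (hc0 : ∀ i t, 0 ≤ c i t)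
    (he : ∀ i u v, IntervalIntegrable (e i) volume u v) {r : ℝ} (hr : 0 ≤ r)
    (her : ∀ i, Function.Periodic (e i) r) (hcr : ∀ i, Function.Periodic (c i) r) :
    N.IsTrajectory e c (fun i t => x i (t + r)) (fun i t => b i (t + r)) := by
  refine ⟨fun i => ?_, fun i => ?_, fun i t => ?_, fun i t ht => ?_, fun i => ?_⟩
  · exact h.queue_nonneg he0 hc0 he i (by linarith)
  · filter_upwards [ae_add_right (h.ae_nonneg hc0 i) r] with s hs hst
    exact hs (by linarith [hst.1])
  · rcases lt_or_ge t (-N.maxDelay) with ht | ht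
    · rw [Icc_eq_empty (not_le.2 ht)]; exact integrableOn_empty
    · rw [← intervalIntegrable_iff_integrableOn_Icc_of_le ht]
      have := (h.intervalIntegrable i (u := -N.maxDelay + r) (v := t + r) (by linarith)
        (by linarith)).comp_add_right r
      simpa only [add_sub_cancel_right] using this
  · have h1 := h.queue_eq_add he i hr (add_nonneg ht hr)
    have h2 : ∀ s, N.arrivals e (fun i t => b i (t + r)) i s = N.arrivals e b i (s + r) := by
      intro s
      simp only [arrivals, her i s]
      congr 1
      refine Finset.sum_congr rfl fun j _ => ?_
      congr 2; ring
    simp only [h2, zero_add]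
    rw [h1, intervalIntegral.integral_comp_add_right (fun s => N.arrivals e b i s - b i s),
      zero_add]
  · filter_upwards [ae_add_right (h.service i) r] with s hs h0
    have := hs (by linarith)
    rwa [hcr i s] at this

end IsTrajectory

end QueueNetwork

/-! ### Comparison of two trajectories, and the role of stability. -/

namespace QueueNetwork

variable {ι : Type*} [Fintype ι] [DecidableEq ι] {N : QueueNetwork ι}

namespace IsTrajectory

variable {e c x b x' b' : ι → ℝ → ℝ}

/-- Where `x > x'`, the first queue is nonempty and `b = c ≥ b'`, so the departures reduce the gap
at rate `|b - b'|`; the case `x < x'` is symmetric. Where `x = x'` and the gap has zero rate, `b -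
b' = a - a'` and the two terms cancel. -/
theorem abs_queue_sub_add_integral_le (h : N.IsTrajectory e c x b)
    (h' : N.IsTrajectory e c x' b') (he0 : ∀ i t, 0 ≤ e i t) (hc0 : ∀ i t, 0 ≤ c i t)
    (he : ∀ i u v, IntervalIntegrable (e i) volume u v) (i : ι) {t : ℝ} (ht : 0 ≤ t) :
    |x i t - x' i t| + ∫ s in (0 : ℝ)..t, |b i s - b' i s| ≤
      |x i 0 - x' i 0| + ∫ s in (0 : ℝ)..t, |N.arrivals e b i s - N.arrivals e b' i s| := by
  have hD := N.maxDelay_nonneg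
  have hb := h.intervalIntegrable i (u := 0) (v := t) (by linarith) (by linarith)
  have hb' := h'.intervalIntegrable i (u := 0) (v := t) (by linarith) (by linarith)
  have ha := h.intervalIntegrable_arrivals he i le_rfl ht
  have ha' := h'.intervalIntegrable_arrivals he i le_rfl ht
  have key := abs_le_abs_add_integral (f := fun s => x i s - x' i s)
    (g := fun s => (N.arrivals e b i s - b i s) - (N.arrivals e b' i s - b' i s))
    (h := fun s => |N.arrivals e b i s - N.arrivals e b' i s| - |b i s - b' i s|) ht
    ((ha.sub hb).sub (ha'.sub hb')) ((ha.sub ha').abs.sub (hb.sub hb').abs)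
    (fun s hs => by
      have hss : uIcc 0 s ⊆ uIcc 0 t := by
        rw [uIcc_of_le hs.1, uIcc_of_le ht]; exact Icc_subset_Icc_right hs.2
      rw [intervalIntegral.integral_sub ((ha.sub hb).mono_set hss) ((ha'.sub hb').mono_set hss),
        h.dynamics i s hs.1, h'.dynamics i s hs.1]
      ring)
    (by
      filter_upwards [h.service i, h'.service i, h.ae_nonneg hc0 i, h'.ae_nonneg hc0 i,
        h.ae_le_service he0 hc0 he i, h'.ae_le_service he0 hc0 he i]
        with s hs hs' hn hn' hle hle' h0
      have hx := h.queue_nonneg he0 hc0 he i h0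
      have hx' := h'.queue_nonneg he0 hc0 he i h0
      have h1 := le_abs_self (N.arrivals e b i s - N.arrivals e b' i s)
      have h2 := neg_abs_le (N.arrivals e b i s - N.arrivals e b' i s)
      refine ⟨fun hp => ?_, fun hn => ?_, fun _ hz => ?_⟩
      · have hbc := (hs h0).1 (by linarith)
        rw [abs_of_nonneg (a := b i s - b' i s) (by linarith [hle' h0])]
        linarith
      · have hbc := (hs' h0).1 (by linarith)
        rw [abs_of_nonpos (a := b i s - b' i s) (by linarith [hle h0])]
        linarith
      · have : b i s - b' i s = N.arrivals e b i s - N.arrivals e b' i s := by linarith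
        rw [this, sub_self])
  rw [intervalIntegral.integral_sub (ha.sub ha').abs (hb.sub hb').abs] at key
  linarith

theorem integral_abs_arrivals_sub_le (h : N.IsTrajectory e c x b)
    (h' : N.IsTrajectory e c x' b') (i : ι) {t : ℝ} (ht : 0 ≤ t) :
    ∫ s in (0 : ℝ)..t, |N.arrivals e b i s - N.arrivals e b' i s| ≤
      ∑ j, (∫ s in (-N.maxDelay)..t, |b j s - b' j s|) * N.r j i := by
  have hD := N.maxDelay_nonneg
  have hint : ∀ j, IntervalIntegrable
      (fun s => |b j (s - N.τ j i) - b' j (s - N.τ j i)| * N.r j i) volume 0 t := fun j =>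
    (((h.intervalIntegrable_comp_sub i j le_rfl ht).sub
      (h'.intervalIntegrable_comp_sub i j le_rfl ht)).abs).mul_const _
  have hpt : ∀ s, |N.arrivals e b i s - N.arrivals e b' i s| ≤
      ∑ j, |b j (s - N.τ j i) - b' j (s - N.τ j i)| * N.r j i := by
    intro s
    have : N.arrivals e b i s - N.arrivals e b' i s =
        ∑ j, (b j (s - N.τ j i) - b' j (s - N.τ j i)) * N.r j i := by
      simp only [arrivals, sub_mul, Finset.sum_sub_distrib]; ring
    rw [this]
    refine (Finset.abs_sum_le_sum_abs _ _).trans (Finset.sum_le_sum fun j _ => ?_)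
    rw [abs_mul, abs_of_nonneg (N.r_nonneg j i)]
  have hdiff : IntervalIntegrable (fun s => N.arrivals e b i s - N.arrivals e b' i s) volume 0 t := by
    have h1 : IntervalIntegrable (∑ j, fun s => (b j (s - N.τ j i) - b' j (s - N.τ j i)) * N.r j i)
        volume 0 t := IntervalIntegrable.sum _ fun j _ =>
      ((h.intervalIntegrable_comp_sub i j le_rfl ht).sub
        (h'.intervalIntegrable_comp_sub i j le_rfl ht)).mul_const _
    refine h1.congr fun s _ => ?_
    simp only [arrivals, sub_mul, Finset.sum_apply, Finset.sum_sub_distrib]; ring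
  have hsum : IntervalIntegrable
      (fun s => ∑ j, |b j (s - N.τ j i) - b' j (s - N.τ j i)| * N.r j i) volume 0 t :=
    (IntervalIntegrable.sum Finset.univ fun j _ => hint j).congr fun s _ => by simp
  refine (intervalIntegral.integral_mono_on ht hdiff.abs hsum fun s _ => hpt s).trans ?_
  rw [intervalIntegral.integral_finsetSum fun j _ => hint j]
  refine Finset.sum_le_sum fun j _ => ?_
  rw [intervalIntegral.integral_mul_const]
  refine mul_le_mul_of_nonneg_right ?_ (N.r_nonneg j i)
  exact integral_comp_sub_le (f := fun s => |b j s - b' j s|) (N.τ_pos j i).le (N.le_maxDelay j i) ht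
    ((h.intervalIntegrable j le_rfl (by linarith)).sub
      (h'.intervalIntegrable j le_rfl (by linarith))).abs
    (Eventually.of_forall fun _ _ => abs_nonneg _)

/-- The total variation between the departure rates of two trajectories is finite. -/
theorem exists_integral_abs_sub_le (h : N.IsTrajectory e c x b)
    (h' : N.IsTrajectory e c x' b') (he0 : ∀ i t, 0 ≤ e i t) (hc0 : ∀ i t, 0 ≤ c i t)
    (he : ∀ i u v, IntervalIntegrable (e i) volume u v) (i : ι) :
    ∃ K, ∀ t, 0 ≤ t → ∫ s in (-N.maxDelay)..t, |b i s - b' i s| ≤ K := by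
  have hD := N.maxDelay_nonneg
  -- The vector `u` involves only the initial data, so the resulting bound does not depend on `t`.
  refine ⟨_, fun t ht => N.le_inv_mulVec
    (u := fun i => (∫ s in (-N.maxDelay)..0, |b i s - b' i s|) + |x i 0 - x' i 0|)
    (v := fun i => ∫ s in (-N.maxDelay)..t, |b i s - b' i s|) (fun i => ?_) i⟩
  have hint : ∀ u v, -N.maxDelay ≤ u → -N.maxDelay ≤ v →
      IntervalIntegrable (fun s => |b i s - b' i s|) volume u v := fun u v hu hv =>
    ((h.intervalIntegrable i hu hv).sub (h'.intervalIntegrable i hu hv)).abs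
  have h1 := h.abs_queue_sub_add_integral_le h' he0 hc0 he i ht
  have h2 := h.integral_abs_arrivals_sub_le h' i ht
  have h3 := intervalIntegral.integral_add_adjacent_intervals
    (hint (-N.maxDelay) 0 le_rfl (by linarith)) (hint 0 t (by linarith) (by linarith))
  have h4 := abs_nonneg (x i t - x' i t)
  linarith

theorem integrableOn_sub (h : N.IsTrajectory e c x b)
    (h' : N.IsTrajectory e c x' b') (he0 : ∀ i t, 0 ≤ e i t) (hc0 : ∀ i t, 0 ≤ c i t)
    (he : ∀ i u v, IntervalIntegrable (e i) volume u v) (i : ι) :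
    IntegrableOn (fun s => b i s - b' i s) (Ioi (-N.maxDelay)) := by
  obtain ⟨K, hK⟩ := h.exists_integral_abs_sub_le h' he0 hc0 he i
  refine integrableOn_Ioi_of_intervalIntegral_norm_bounded K _ (l := atTop) (b := id)
    (fun t => ?_) tendsto_id ?_
  · exact ((h.integrable i t).sub (h'.integrable i t)).mono_set Ioc_subset_Icc_self
  · filter_upwards [eventually_ge_atTop 0] with t ht using hK t ht

/-- The gap between the queues has a rate of change that is integrable on the half-line, by the
uniform bounds on `∫ |b - b'|` at all queues. -/
theorem exists_tendsto_queue_sub (h : N.IsTrajectory e c x b)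
    (h' : N.IsTrajectory e c x' b') (he0 : ∀ i t, 0 ≤ e i t) (hc0 : ∀ i t, 0 ≤ c i t)
    (he : ∀ i u v, IntervalIntegrable (e i) volume u v) (i : ι) :
    ∃ l, Tendsto (fun t => x i t - x' i t) atTop (𝓝 l) := by
  have hD := N.maxDelay_nonneg
  choose K hK using h.exists_integral_abs_sub_le h' he0 hc0 he
  set g : ℝ → ℝ := fun s =>
    (N.arrivals e b i s - N.arrivals e b' i s) - (b i s - b' i s) with hg
  have ha : ∀ t, 0 ≤ t → IntervalIntegrable
      (fun s => N.arrivals e b i s - N.arrivals e b' i s) volume 0 t := fun t ht =>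
    (h.intervalIntegrable_arrivals he i le_rfl ht).sub
      (h'.intervalIntegrable_arrivals he i le_rfl ht)
  have hb : ∀ u t, -N.maxDelay ≤ u → -N.maxDelay ≤ t →
      IntervalIntegrable (fun s => b i s - b' i s) volume u t := fun u t hu ht =>
    (h.intervalIntegrable i hu ht).sub (h'.intervalIntegrable i hu ht)
  have hgi : ∀ t, 0 ≤ t → IntervalIntegrable g volume 0 t := fun t ht =>
    (ha t ht).sub (hb 0 t (by linarith) (by linarith))
  have hint : IntegrableOn g (Ioi 0) := by
    refine integrableOn_Ioi_of_intervalIntegral_norm_bounded ((∑ j, K j * N.r j i) + K i) _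
      (l := atTop) (b := id) (fun t => ?_) tendsto_id ?_
    · rcases le_total 0 t with ht | ht
      · exact (intervalIntegrable_iff_integrableOn_Ioc_of_le ht).1 (hgi t ht)
      · rw [id, Ioc_eq_empty (not_lt.2 ht)]; exact integrableOn_empty
    · filter_upwards [eventually_ge_atTop 0] with t ht
      have hb0 := hb 0 t (by linarith) (by linarith)
      have h1 : ∫ s in (0 : ℝ)..t, ‖g s‖ ≤ ∫ s in (0 : ℝ)..t,
          (|N.arrivals e b i s - N.arrivals e b' i s| + |b i s - b' i s|) :=
        intervalIntegral.integral_mono_on ht (hgi t ht).norm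
          ((ha t ht).abs.add hb0.abs) fun s _ => abs_sub _ _
      rw [intervalIntegral.integral_add (ha t ht).abs hb0.abs] at h1
      have h2 := h.integral_abs_arrivals_sub_le h' i ht
      have h3 : ∑ j, (∫ s in (-N.maxDelay)..t, |b j s - b' j s|) * N.r j i ≤
          ∑ j, K j * N.r j i :=
        Finset.sum_le_sum fun j _ => mul_le_mul_of_nonneg_right (hK j t ht) (N.r_nonneg j i)
      have h4 : ∫ s in (0 : ℝ)..t, |b i s - b' i s| ≤
          ∫ s in (-N.maxDelay)..t, |b i s - b' i s| :=
        intervalIntegral.integral_mono_interval (by linarith) ht le_rfl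
          (Eventually.of_forall fun _ => abs_nonneg _) (hb _ t le_rfl (by linarith)).abs
      have h5 := hK i t ht
      exact h1.trans (by linarith)
  have hlim := (intervalIntegral_tendsto_integral_Ioi 0 hint tendsto_id).const_add
    (x i 0 - x' i 0)
  refine ⟨_, hlim.congr' ?_⟩
  filter_upwards [eventually_ge_atTop 0] with t ht
  have hb1 := h.intervalIntegrable i (u := 0) (v := t) (by linarith) (by linarith)
  have hb1' := h'.intervalIntegrable i (u := 0) (v := t) (by linarith) (by linarith)
  have ha1 := h.intervalIntegrable_arrivals he i le_rfl ht
  have ha1' := h'.intervalIntegrable_arrivals he i le_rfl ht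
  have : ∫ s in (0 : ℝ)..t, g s = (∫ s in (0 : ℝ)..t, (N.arrivals e b i s - b i s)) -
      ∫ s in (0 : ℝ)..t, (N.arrivals e b' i s - b' i s) := by
    rw [← intervalIntegral.integral_sub (ha1.sub hb1) (ha1'.sub hb1')]
    exact intervalIntegral.integral_congr fun s _ => by simp only [hg]; ring
  rw [id, this, h.dynamics i t ht, h'.dynamics i t ht]
  ring

/-- The cumulative departures grow at most at the rate of the traffic equation. -/
theorem integral_departures_le (h : N.IsTrajectory e c x b) (he0 : ∀ i t, 0 ≤ e i t)
    (hc0 : ∀ i t, 0 ≤ c i t) (he : ∀ i u v, IntervalIntegrable (e i) volume u v) {t : ℝ}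
    (ht : 0 ≤ t) (i : ι) :
    ∫ s in (-N.maxDelay)..t, b i s ≤ ((1 - N.r.transpose)⁻¹.mulVec
      fun i => (∫ s in (-N.maxDelay)..0, b i s) + x i 0 + ∫ s in (0 : ℝ)..t, e i s) i := by
  have hD := N.maxDelay_nonneg
  refine N.le_inv_mulVec (v := fun i => ∫ s in (-N.maxDelay)..t, b i s) (fun i => ?_) i
  have hb := h.intervalIntegrable i (u := 0) (v := t) (by linarith) (by linarith)
  have h1 := intervalIntegral.integral_add_adjacent_intervals
    (h.intervalIntegrable i (u := -N.maxDelay) (v := 0) le_rfl (by linarith)) hb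
  -- Departures cannot exceed the initial queue plus the arrivals; this is the traffic inequality.
  have h2 := h.queue_nonneg he0 hc0 he i ht
  rw [h.dynamics i t ht, intervalIntegral.integral_sub
    (h.intervalIntegrable_arrivals he i le_rfl ht) hb] at h2
  have hint : ∀ j, IntervalIntegrable (fun s => b j (s - N.τ j i) * N.r j i) volume 0 t := fun j =>
    (h.intervalIntegrable_comp_sub i j le_rfl ht).mul_const _
  have hsum : IntervalIntegrable (fun s => ∑ j, b j (s - N.τ j i) * N.r j i) volume 0 t :=
    (IntervalIntegrable.sum Finset.univ fun j _ => hint j).congr fun s _ => by simp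
  have h3 : ∫ s in (0 : ℝ)..t, N.arrivals e b i s =
      (∫ s in (0 : ℝ)..t, e i s) + ∑ j, (∫ s in (0 : ℝ)..t, b j (s - N.τ j i)) * N.r j i := by
    simp only [arrivals]
    rw [intervalIntegral.integral_add (he i 0 t) hsum,
      intervalIntegral.integral_finsetSum fun j _ => hint j]
    simp only [intervalIntegral.integral_mul_const]
  have h4 : ∑ j, (∫ s in (0 : ℝ)..t, b j (s - N.τ j i)) * N.r j i ≤
      ∑ j, (∫ s in (-N.maxDelay)..t, b j s) * N.r j i :=
    Finset.sum_le_sum fun j _ => mul_le_mul_of_nonneg_right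
      (integral_comp_sub_le (N.τ_pos j i).le (N.le_maxDelay j i) ht
        (h.intervalIntegrable j le_rfl (by linarith)) (h.ae_nonneg hc0 j)) (N.r_nonneg j i)
  linarith

theorem integral_nat_mul_period {f : ℝ → ℝ} {T : ℝ} (hf : Function.Periodic f T)
    (hint : ∀ u v, IntervalIntegrable f volume u v) (n : ℕ) :
    ∫ s in (0 : ℝ)..n * T, f s = n * ∫ s in (0 : ℝ)..T, f s := by
  have := hf.intervalIntegral_add_zsmul_eq n 0 hint
  simpa using this

/-- Under the stability condition every queue empties again and again. -/
theorem not_eventually_pos (h : N.IsTrajectory e c x b) (he0 : ∀ i t, 0 ≤ e i t)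
    (hc0 : ∀ i t, 0 ≤ c i t) (he : ∀ i u v, IntervalIntegrable (e i) volume u v)
    (hc : ∀ i u v, IntervalIntegrable (c i) volume u v) {T : ℝ} (hT : 0 < T)
    (he_per : ∀ i, Function.Periodic (e i) T) (hc_per : ∀ i, Function.Periodic (c i) T)
    (hstable : N.Stable T e c) (i : ι) : ¬ ∀ᶠ t in atTop, 0 < x i t := by
  intro hpos
  have hD := N.maxDelay_nonneg
  obtain ⟨ε, hε, hst⟩ := hstable
  obtain ⟨t₀, ht₀⟩ := eventually_atTop.1 hpos
  obtain ⟨m, hm⟩ := exists_nat_ge (t₀ / T)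
  rw [div_le_iff₀ hT] at hm
  set M := (1 - N.r.transpose)⁻¹
  set E : ι → ℝ := fun i => ∫ s in (0 : ℝ)..T, e i s
  set C : ℝ := ∫ s in (0 : ℝ)..T, c i s
  set u : ι → ℝ := fun i => (∫ s in (-N.maxDelay)..0, b i s) + x i 0
  -- Stability per period: capacity exceeds the traffic load by more than `ε * T`.
  have hrate : M.mulVec E i + ε * T < C := by
    have h1 := hst i
    have h2 : periodAverage T e = (1 / T) • E := by
      ext j; simp [periodAverage, E]
    rw [h2, Matrix.mulVec_smul, Pi.smul_apply, smul_eq_mul, periodAverage] at h1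
    have h3 := mul_lt_mul_of_pos_right h1 hT
    have h4 : (1 / T * M.mulVec E i + ε) * T = M.mulVec E i + ε * T := by field_simp
    have h5 : 1 / T * C * T = C := by field_simp
    rw [h4, h5] at h3
    exact h3
  have hupper : ∀ n : ℕ, ∫ s in (-N.maxDelay)..n * T, b i s ≤ M.mulVec u i + n * M.mulVec E i := by
    intro n
    have h1 := h.integral_departures_le he0 hc0 he (t := n * T) (by positivity) i
    have h2 : (fun i => (∫ s in (-N.maxDelay)..0, b i s) + x i 0 + ∫ s in (0 : ℝ)..n * T, e i s) =
        u + (n : ℝ) • E := by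
      ext j
      simp only [u, E, Pi.add_apply, Pi.smul_apply, smul_eq_mul]
      rw [integral_nat_mul_period (he_per j) (he j)]
    rw [h2, Matrix.mulVec_add, Matrix.mulVec_smul] at h1
    exact h1
  have hlower : ∀ n : ℕ, m ≤ n → (n - m) * C ≤ ∫ s in (-N.maxDelay)..n * T, b i s := by
    intro n hmn
    have hmT : (0 : ℝ) ≤ m * T := by positivity
    have hmnT : (m : ℝ) * T ≤ n * T := by gcongr
    have h1 : ∫ s in (m * T)..(n * T), b i s = ∫ s in (m * T)..(n * T), c i s := by
      refine intervalIntegral.integral_congr_ae ?_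
      filter_upwards [h.service i] with s hs hst
      rw [uIoc_of_le hmnT] at hst
      exact (hs (hmT.trans hst.1.le)).1 (ht₀ s (hm.trans hst.1.le))
    have h2 := intervalIntegral.integral_interval_sub_left (hc i 0 (n * T)) (hc i 0 (m * T))
    rw [integral_nat_mul_period (hc_per i) (hc i), integral_nat_mul_period (hc_per i) (hc i)] at h2
    have h3 : ∫ s in (m * T)..(n * T), b i s ≤ ∫ s in (-N.maxDelay)..n * T, b i s := by
      refine intervalIntegral.integral_mono_interval (by linarith) hmnT le_rfl ?_
        (h.intervalIntegrable i le_rfl (by linarith))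
      rw [Filter.EventuallyLE, ae_restrict_iff' measurableSet_Ioc]
      filter_upwards [h.ae_nonneg hc0 i] with s hs hst using hs hst.1.le
    rw [h1, ← h2] at h3
    linarith
  -- After `n` periods the accumulated slack `n * (ε * T)` exceeds all constants in the two bounds;
  -- `max m n` keeps the lower bound applicable.
  obtain ⟨n, hn⟩ := exists_nat_gt ((M.mulVec u i + m * C) / (ε * T))
  rw [div_lt_iff₀ (by positivity)] at hn
  have hmax : (n : ℝ) ≤ (max m n : ℕ) := by exact_mod_cast le_max_right m n
  have h1 := hupper (max m n)
  have h2 := hlower (max m n) (le_max_left m n)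
  have h3 : (n : ℝ) * (ε * T) ≤ (max m n : ℕ) * (ε * T) := by gcongr
  have h4 : ((max m n : ℕ) : ℝ) * (M.mulVec E i + ε * T) ≤ (max m n : ℕ) * C := by gcongr
  linarith

/-- Any two trajectories converge to each other. -/
theorem convergesTo (h : N.IsTrajectory e c x b) (h' : N.IsTrajectory e c x' b')
    (he0 : ∀ i t, 0 ≤ e i t)
    (hc0 : ∀ i t, 0 ≤ c i t) (he : ∀ i u v, IntervalIntegrable (e i) volume u v)
    (hc : ∀ i u v, IntervalIntegrable (c i) volume u v) {T : ℝ} (hT : 0 < T)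
    (he_per : ∀ i, Function.Periodic (e i) T) (hc_per : ∀ i, Function.Periodic (c i) T)
    (hstable : N.Stable T e c) : N.ConvergesTo x b x' b' := by
  have hD := N.maxDelay_nonneg
  intro i
  constructor
  · obtain ⟨l, hl⟩ := h.exists_tendsto_queue_sub h' he0 hc0 he i
    -- Queues are nonnegative, so a nonzero limit of `x - x'` would keep one of the two eventually
    -- positive.
    have hl0 : l = 0 := by
      rcases lt_trichotomy l 0 with hlt | heq | hgt
      · refine absurd ?_ (h'.not_eventually_pos he0 hc0 he hc hT he_per hc_per hstable i)
        filter_upwards [hl.eventually_lt_const hlt, eventually_ge_atTop 0] with t h1 h2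
        linarith [h.queue_nonneg he0 hc0 he i h2]
      · exact heq
      · refine absurd ?_ (h.not_eventually_pos he0 hc0 he hc hT he_per hc_per hstable i)
        filter_upwards [hl.eventually_const_lt hgt, eventually_ge_atTop 0] with t h1 h2
        linarith [h'.queue_nonneg he0 hc0 he i h2]
    rw [hl0] at hl
    simpa using hl.abs
  -- The integrals up to `t` and up to `t - τ̄` have the same limit, so the window between them
  -- contributes nothing in the limit.
  · have hint := (h.integrableOn_sub h' he0 hc0 he i).norm
    have h1 := intervalIntegral_tendsto_integral_Ioi (l := atTop) (b := fun t : ℝ => t) _ hint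
      tendsto_id
    have h2 := intervalIntegral_tendsto_integral_Ioi (l := atTop)
      (b := fun t : ℝ => t - N.maxDelay) _ hint (tendsto_atTop_add_const_right _ _ tendsto_id)
    have h3 := h1.sub h2
    rw [sub_self] at h3
    refine h3.congr' ?_
    filter_upwards [eventually_ge_atTop 0] with t ht
    have hi : ∀ v, -N.maxDelay ≤ v →
        IntervalIntegrable (fun s => ‖b i s - b' i s‖) volume (-N.maxDelay) v := fun v hv =>
      ((h.intervalIntegrable i le_rfl hv).sub (h'.intervalIntegrable i le_rfl hv)).norm
    rw [intervalIntegral.integral_interval_sub_left (hi _ (by linarith)) (hi _ (by linarith)),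
      intervalIntegral.integral_comp_add_left (fun s => |b i s - b' i s|)]
    simp only [Real.norm_eq_abs, add_zero, sub_eq_add_neg]

end IsTrajectory

end QueueNetwork

/-! ### Limits of translates by multiples of the period. -/

/-- If the increments of `f` over a period are integrable, then the translates of `f` by multiples
of the period converge almost everywhere. -/
theorem ae_tendsto_limUnder_add_nat_mul {f : ℝ → ℝ} {T : ℝ} (hT : 0 < T)
    (hf : IntegrableOn (fun t => f (t + T) - f t) (Ioi 0)) :
    ∀ᵐ t, Tendsto (fun n : ℕ => f (t + n * T)) atTop
      (𝓝 (limUnder atTop fun n : ℕ => f (t + n * T))) := by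
  set g : ℝ → ℝ := fun t => f (t + T) - f t with hg
  have hsub : ∀ n : ℕ, Ioc ((n : ℝ) * T) ((n + 1 : ℕ) * T) ⊆ Ioi 0 := fun n s hs =>
    lt_of_le_of_lt (by positivity) hs.1
  have hpre : ∀ n : ℕ, (fun t : ℝ => t + n * T) ⁻¹' Ioc ((n : ℝ) * T) ((n + 1 : ℕ) * T) =
      Ioc 0 T := fun n => by
    ext t; simp only [mem_preimage, mem_Ioc]; push_cast
    constructor <;> rintro ⟨h1, h2⟩ <;> constructor <;> linarith
  have hmp : ∀ n : ℕ, MeasurePreserving (fun t : ℝ => t + n * T) volume volume := fun n =>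
    measurePreserving_add_right volume _
  have hmeas : ∀ n : ℕ, AEMeasurable (fun t => ‖g (t + n * T)‖ₑ) (volume.restrict (Ioc 0 T)) := by
    intro n
    have h1 := (hf.mono_set (hsub n)).aestronglyMeasurable
    have h2 := (hmp n).restrict_preimage (s := Ioc ((n : ℝ) * T) ((n + 1 : ℕ) * T))
      measurableSet_Ioc
    rw [hpre n] at h2
    exact (h1.comp_measurePreserving h2).enorm
  -- By Tonelli, the sum over all periods is an integral of `|g|` over part of `(0, ∞)`, hence
  -- finite. So for almost every `t` in one period the increments are summable and the sequence is
  -- Cauchy.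
  have hsum : ∫⁻ t in Ioc 0 T, ∑' n : ℕ, ‖g (t + n * T)‖ₑ ≠ ⊤ := by
    rw [lintegral_tsum hmeas]
    have h1 : ∀ n : ℕ, ∫⁻ t in Ioc 0 T, ‖g (t + n * T)‖ₑ =
        ∫⁻ t in Ioc ((n : ℝ) * T) ((n + 1 : ℕ) * T), ‖g t‖ₑ := fun n => by
      rw [← hpre n]
      exact (hmp n).setLIntegral_comp_preimage_emb
        (MeasurableEquiv.addRight ((n : ℝ) * T)).measurableEmbedding (fun t => ‖g t‖ₑ) _
    have hmono : Monotone fun n : ℕ => (n : ℝ) * T := fun m n hmn => by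
      simp only; gcongr
    simp_rw [h1]
    have hdisj : Pairwise (Function.onFun Disjoint fun n : ℕ =>
        Ioc ((n : ℝ) * T) ((n + 1 : ℕ) * T)) := hmono.pairwise_disjoint_on_Ioc_succ
    rw [← lintegral_iUnion (fun n => measurableSet_Ioc) hdisj]
    exact ((lintegral_mono_set (iUnion_subset hsub)).trans_lt hf.hasFiniteIntegral).ne
  have hbase : ∀ᵐ t, t ∈ Ioc 0 T → ∃ l, Tendsto (fun n : ℕ => f (t + n * T)) atTop (𝓝 l) := by
    rw [← ae_restrict_iff' measurableSet_Ioc]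
    filter_upwards [ae_lt_top' (AEMeasurable.tsum hmeas) hsum] with t ht
    refine cauchySeq_tendsto_of_complete (cauchySeq_of_summable_dist ?_)
    have h1 : Summable fun n : ℕ => ‖g (t + n * T)‖ := by
      have h2 : Summable fun n : ℕ => ‖g (t + n * T)‖₊ :=
        ENNReal.tsum_coe_ne_top_iff_summable.1 ht.ne
      exact NNReal.summable_coe.2 h2
    refine h1.congr fun n => ?_
    rw [dist_comm, Real.dist_eq, Real.norm_eq_abs, hg]
    simp only
    congr 3
    push_cast; ring
  -- Every `t` is carried into `(0, T]` by an integer multiple of `T`; countably many null sets are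
  -- discarded, and the index shift does not affect the limit.
  have hshift : ∀ᵐ t : ℝ, ∀ m : ℤ, t + m * T ∈ Ioc 0 T →
      ∃ l, Tendsto (fun n : ℕ => f (t + m * T + n * T)) atTop (𝓝 l) :=
    ae_all_iff.2 fun m => ae_add_right hbase _
  filter_upwards [hshift] with t ht
  refine tendsto_nhds_limUnder ?_
  obtain ⟨m, hm, -⟩ := existsUnique_add_zsmul_mem_Ioc hT t 0
  rw [zsmul_eq_mul, zero_add] at hm
  obtain ⟨l, hl⟩ := ht m hm
  refine ⟨l, ?_⟩
  obtain ⟨k, rfl | rfl⟩ := m.eq_nat_or_neg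
  · refine (tendsto_add_atTop_iff_nat k).1 (hl.congr fun n => ?_)
    congr 1; push_cast; ring
  · refine ((tendsto_add_atTop_iff_nat k).2 hl).congr fun n => ?_
    congr 1; push_cast; ring

/-- Moving `t` by `T` only drops the first term of the sequence. The identity holds even where there
is no limit, so the periodicity is exact at every time. -/
theorem limUnder_add_nat_mul_periodic (f : ℝ → ℝ) (T : ℝ) :
    Function.Periodic (fun t => limUnder atTop fun n : ℕ => f (t + n * T)) T := by
  intro t
  have h1 : (fun n : ℕ => f (t + T + n * T)) = (fun n : ℕ => f (t + n * T)) ∘ (· + 1) := by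
    ext n; simp only [Function.comp]; congr 1; push_cast; ring
  simp only [limUnder]
  rw [h1, ← Filter.map_map, map_add_atTop_eq_nat]

/-! ### The periodic trajectory. -/

namespace QueueNetwork

variable {ι : Type*} [Fintype ι] [DecidableEq ι] {N : QueueNetwork ι}

namespace IsTrajectory

variable {e c x b : ι → ℝ → ℝ}

/-- The queue lengths at the ends of the periods do not tend to infinity. -/
theorem exists_frequently_queue_le (h : N.IsTrajectory e c x b) (he0 : ∀ i t, 0 ≤ e i t)
    (hc0 : ∀ i t, 0 ≤ c i t) (he : ∀ i u v, IntervalIntegrable (e i) volume u v)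
    (hc : ∀ i u v, IntervalIntegrable (c i) volume u v) {T : ℝ} (hT : 0 < T)
    (he_per : ∀ i, Function.Periodic (e i) T) (hc_per : ∀ i, Function.Periodic (c i) T)
    (hstable : N.Stable T e c) (i : ι) :
    ∃ K, ∃ᶠ n : ℕ in atTop, x i (n * T) ∈ Icc 0 K := by
  have hD := N.maxDelay_nonneg
  by_contra! hcon
  refine h.not_eventually_pos he0 hc0 he hc hT he_per hc_per hstable i ?_
  -- The threshold is the service capacity of one period: a queue longer than this at the start of a
  -- period cannot empty during it.
  obtain ⟨n₀, hn₀⟩ := eventually_atTop.1 (hcon (∫ s in (0 : ℝ)..T, c i s))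
  filter_upwards [eventually_ge_atTop (n₀ * T)] with t ht
  have ht0 : 0 ≤ t := le_trans (by positivity) ht
  set n := ⌊t / T⌋₊
  have hn : n₀ ≤ n := Nat.le_floor ((le_div_iff₀ hT).2 ht)
  have hnt : n * T ≤ t := (le_div_iff₀ hT).1 (Nat.floor_le (by positivity))
  have htn : t ≤ n * T + T := by
    have := (div_lt_iff₀ hT).1 (Nat.lt_floor_add_one (t / T)); linarith
  have hnT : (0 : ℝ) ≤ n * T := by positivity
  have h1 : ∫ s in (0 : ℝ)..T, c i s < x i (n * T) := by
    by_contra! hle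
    exact hn₀ n hn (mem_Icc.2 ⟨h.queue_nonneg he0 hc0 he i hnT, hle⟩)
  have h2 := h.queue_eq_add he i hnT ht0
  have h3 : -∫ s in (n * T)..t, c i s ≤ ∫ s in (n * T)..t, (N.arrivals e b i s - b i s) := by
    rw [← intervalIntegral.integral_neg]
    refine intervalIntegral.integral_mono_ae_restrict hnt (hc i _ _).neg
      ((h.intervalIntegrable_arrivals he i hnT ht0).sub
        (h.intervalIntegrable i (by linarith) (by linarith))) ?_
    rw [Filter.EventuallyLE, ae_restrict_iff' measurableSet_Icc]
    filter_upwards [h.ae_arrivals_nonneg he0 hc0 i, h.ae_le_service he0 hc0 he i] with s hs hs' hst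
    have h0 := hnT.trans hst.1
    linarith [hs h0, hs' h0]
  have h4 : ∫ s in (n * T)..t, c i s ≤ ∫ s in (n * T)..(n * T + T), c i s :=
    intervalIntegral.integral_mono_interval le_rfl hnt htn
      (Eventually.of_forall fun s => hc0 i s) (hc i _ _)
  rw [(hc_per i).intervalIntegral_add_eq (n * T) 0, zero_add] at h4
  linarith

/-- The periodic trajectory is the limit of the translates of the given one by whole periods.
Departure rates converge along the full sequence, queue lengths a priori only along subsequences. -/
theorem exists_periodic (h : N.IsTrajectory e c x b) (he0 : ∀ i t, 0 ≤ e i t)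
    (hc0 : ∀ i t, 0 ≤ c i t) (he : ∀ i u v, IntervalIntegrable (e i) volume u v)
    (hc : ∀ i u v, IntervalIntegrable (c i) volume u v) {T : ℝ} (hT : 0 < T)
    (he_per : ∀ i, Function.Periodic (e i) T) (hc_per : ∀ i, Function.Periodic (c i) T)
    (hstable : N.Stable T e c) :
    ∃ xs bs, N.IsTrajectory e c xs bs ∧ N.IsPeriodicState T xs bs := by
  have hD := N.maxDelay_nonneg
  have hn : ∀ n : ℕ, N.IsTrajectory e c (fun i t => x i (t + n * T))
      (fun i t => b i (t + n * T)) := fun n =>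
    h.shift he0 hc0 he (by positivity) (fun i => (he_per i).nat_mul n)
      fun i => (hc_per i).nat_mul n
  have h1 := h.shift he0 hc0 he hT.le he_per hc_per
  set bs : ι → ℝ → ℝ := fun i t => limUnder atTop fun n : ℕ => b i (t + n * T) with hbs
  have hbs_per : ∀ i, Function.Periodic (bs i) T := fun i => limUnder_add_nat_mul_periodic (b i) T
  have hlim : ∀ i, ∀ᵐ t, Tendsto (fun n : ℕ => b i (t + n * T)) atTop (𝓝 (bs i t)) := fun i =>
    ae_tendsto_limUnder_add_nat_mul hT ((h1.integrableOn_sub h he0 hc0 he i).mono_set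
      (Ioi_subset_Ioi (by linarith)))
  have hbd : ∀ i, ∀ᵐ t, ∀ n : ℕ, 0 ≤ t + n * T → b i (t + n * T) ∈ Icc 0 (c i t) := by
    intro i
    refine ae_all_iff.2 fun n => ?_
    filter_upwards [ae_add_right (h.ae_nonneg hc0 i) (n * T),
      ae_add_right (h.ae_le_service he0 hc0 he i) (n * T)] with t ht ht' h0
    have := ht' h0
    rw [(hc_per i).nat_mul n t] at this
    exact ⟨ht (by linarith), this⟩
  have hlarge : ∀ t : ℝ, ∀ᶠ n : ℕ in atTop, 0 ≤ t + n * T := fun t =>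
    (tendsto_atTop_add_const_left _ t
      (tendsto_natCast_atTop_atTop.atTop_mul_const hT)).eventually_ge_atTop 0
  have hbs_mem : ∀ i, ∀ᵐ t, bs i t ∈ Icc 0 (c i t) := by
    intro i
    filter_upwards [hlim i, hbd i] with t ht ht'
    exact isClosed_Icc.mem_of_tendsto ht ((hlarge t).mono fun n hn => ht' n hn)
  have hbs_int : ∀ i u v, IntervalIntegrable (bs i) volume u v := by
    intro i u v
    refine (hc i u v).mono_fun ?_ ?_
    -- The first `k` translates are skipped, since `b` is known to be integrable only from time
    -- `-τ̄` on.
    · obtain ⟨k, hk⟩ := eventually_atTop.1 (hlarge (min u v))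
      refine aestronglyMeasurable_of_tendsto_ae atTop (f := fun (n : ℕ) t => b i (t + (n + k : ℕ) * T))
        (fun n => ?_) ?_
      · have h2 := hk (n + k) (Nat.le_add_left k n)
        have h3 := (h.intervalIntegrable i (u := u + (n + k : ℕ) * T) (v := v + (n + k : ℕ) * T)
          (by linarith [min_le_left u v]) (by linarith [min_le_right u v])).comp_add_right
          ((n + k : ℕ) * T)
        simp only [add_sub_cancel_right] at h3
        exact h3.aestronglyMeasurable_restrict_uIoc
      · exact ae_restrict_of_ae ((hlim i).mono fun t ht => (tendsto_add_atTop_iff_nat k).2 ht)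
    · refine ae_restrict_of_ae ((hbs_mem i).mono fun t ht => ?_)
      simp only [Real.norm_of_nonneg ht.1, Real.norm_of_nonneg (hc0 i t), ht.2]
  have hint : ∀ i t, 0 ≤ t → Tendsto (fun n : ℕ => ∫ s in (0 : ℝ)..t,
      (N.arrivals e (fun i t => b i (t + n * T)) i s - b i (s + n * T))) atTop
      (𝓝 (∫ s in (0 : ℝ)..t, (N.arrivals e bs i s - bs i s))) := by
    intro i t ht
    have hbd' : ∀ᵐ s, ∀ j, ∀ n : ℕ, 0 ≤ s - N.τ j i + n * T →
        b j (s - N.τ j i + n * T) ∈ Icc 0 (c j (s - N.τ j i)) :=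
      ae_all_iff.2 fun j => ae_sub_right (hbd j) _
    have hlim' : ∀ᵐ s, ∀ j, Tendsto (fun n : ℕ => b j (s - N.τ j i + n * T)) atTop
        (𝓝 (bs j (s - N.τ j i))) := ae_all_iff.2 fun j => ae_sub_right (hlim j) _
    refine intervalIntegral.tendsto_integral_filter_of_dominated_convergence
      (fun s => N.arrivals e c i s + c i s) ?_ ?_ ?_ ?_
    · refine Eventually.of_forall fun n => ?_
      exact (((hn n).intervalIntegrable_arrivals he i le_rfl ht).sub
        ((hn n).intervalIntegrable i (by linarith) (by linarith))).aestronglyMeasurable_restrict_uIoc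
    -- Domination by service rates holds only for large `n`: the initial history need not be bounded
    -- by `c`.
    · filter_upwards [hlarge (-N.maxDelay)] with n hnD
      filter_upwards [hbd', hbd i] with s hs hs' hst
      rw [uIoc_of_le ht] at hst
      have h2 := hs' n (by linarith [hst.1])
      have h3 : 0 ≤ N.arrivals e (fun i t => b i (t + n * T)) i s :=
        add_nonneg (he0 i s) (Finset.sum_nonneg fun j _ => mul_nonneg
          (hs j n (by linarith [hst.1, N.le_maxDelay j i])).1 (N.r_nonneg j i))
      have h4 : N.arrivals e (fun i t => b i (t + n * T)) i s ≤ N.arrivals e c i s :=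
        add_le_add_right (Finset.sum_le_sum fun j _ => mul_le_mul_of_nonneg_right
          (hs j n (by linarith [hst.1, N.le_maxDelay j i])).2 (N.r_nonneg j i)) _
      rw [Real.norm_eq_abs, abs_le]
      constructor <;> linarith [h2.1, h2.2]
    · exact (N.intervalIntegrable_arrivals (he i _ _) fun j => hc j _ _).add (hc i _ _)
    · filter_upwards [hlim', hlim i] with s hs hs' _
      exact (tendsto_const_nhds.add
        (tendsto_finsetSum _ fun j _ => (hs j).mul_const _)).sub hs'
  -- The subsequence may depend on the queue, because `hint` gives convergence of the integrals
  -- along the full sequence.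
  have hsub : ∀ i, ∃ ξ, ∃ φ : ℕ → ℕ, StrictMono φ ∧
      Tendsto (fun n => x i (φ n * T)) atTop (𝓝 ξ) := by
    intro i
    obtain ⟨K, hK⟩ := h.exists_frequently_queue_le he0 hc0 he hc hT he_per hc_per hstable i
    obtain ⟨ξ, -, φ, hφ, hξ⟩ := tendsto_subseq_of_frequently_bounded
      (Metric.isBounded_Icc (0 : ℝ) K) (x := fun n : ℕ => x i (n * T)) hK
    exact ⟨ξ, φ, hφ, hξ⟩
  choose ξ φ hφ hξ using hsub
  set xs : ι → ℝ → ℝ := fun i t => ξ i + ∫ s in (0 : ℝ)..t, (N.arrivals e bs i s - bs i s) with hxs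
  have hxlim : ∀ i t, 0 ≤ t → Tendsto (fun n => x i (t + φ i n * T)) atTop (𝓝 (xs i t)) := by
    intro i t ht
    refine ((hξ i).add ((hint i t ht).comp (hφ i).tendsto_atTop)).congr fun n => ?_
    have := (hn (φ i n)).dynamics i t ht
    simp only [zero_add] at this
    rw [this]; rfl
  have hxs_nonneg : ∀ i t, 0 ≤ t → 0 ≤ xs i t := fun i t ht =>
    ge_of_tendsto' (hxlim i t ht) fun n =>
      h.queue_nonneg he0 hc0 he i (add_nonneg ht (by positivity))
  have hxs0 : ∀ i, xs i 0 = ξ i := fun i => by simp [hxs]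
  refine ⟨xs, bs, ⟨fun i => hxs_nonneg i 0 le_rfl, fun i => (hbs_mem i).mono fun t ht _ => ht.1,
    fun i t => ?_, fun i t _ => by rw [hxs0], fun i => ?_⟩, fun t ht i => ⟨?_, ?_⟩⟩
  · rcases lt_or_ge t (-N.maxDelay) with ht | ht
    · rw [Icc_eq_empty (not_le.2 ht)]; exact integrableOn_empty
    · exact (intervalIntegrable_iff_integrableOn_Icc_of_le ht).1 (hbs_int i _ _)
  · filter_upwards [ae_all_iff.2 fun n => (hn n).service i, hlim i, hbs_mem i] with t hs hl hm ht
    refine ⟨fun hpos => ?_, fun _ => hm, fun hneg => absurd (hxs_nonneg i t ht) (not_le.2 hneg)⟩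
    -- If the limit queue is positive, so are its approximants eventually; they are served at
    -- exactly `c i t`, hence so is the limit.
    refine tendsto_nhds_unique (hl.comp (hφ i).tendsto_atTop)
      ((tendsto_const_nhds (x := c i t)).congr' ?_)
    filter_upwards [(hxlim i t ht).eventually_const_lt hpos] with n hxn
    exact ((hs (φ i n) ht).1 hxn).symm
  -- The original trajectory and its shift by `T` converge to each other, so the limits at `t + T`
  -- and at `t` agree.
  · have h2 := ((h1.convergesTo h he0 hc0 he hc hT he_per hc_per hstable) i).1
    have h3 : Tendsto (fun n : ℕ => t + φ i n * T) atTop atTop :=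
      tendsto_atTop_add_const_left _ t ((tendsto_natCast_atTop_atTop.comp
        (hφ i).tendsto_atTop).atTop_mul_const hT)
    have h4 := ((hxlim i (t + T) (by linarith)).sub (hxlim i t ht)).abs
    have h5 := (h2.comp h3).congr (f₂ := fun n : ℕ =>
      |x i (t + T + φ i n * T) - x i (t + φ i n * T)|) fun n => by
        simp only [Function.comp]; congr 3; ring
    exact sub_eq_zero.1 (abs_eq_zero.1 (tendsto_nhds_unique h4 h5))
  · refine Eventually.of_forall fun s _ => ?_
    rw [add_right_comm]
    exact hbs_per i _

/-- Periodic states that converge to each other are equal. -/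
theorem sameState_of_convergesTo {x' b' : ι → ℝ → ℝ} (h : N.IsTrajectory e c x b)
    (h' : N.IsTrajectory e c x' b') {T : ℝ} (hT : 0 < T) (hp : N.IsPeriodicState T x b)
    (hp' : N.IsPeriodicState T x' b') (hconv : N.ConvergesTo x b x' b') {t : ℝ} (ht : 0 ≤ t) :
    N.SameState x b t x' b' t := by
  have hD := N.maxDelay_nonneg
  -- Sampled at `t + n * T`, both differences are constant in `n`; as they tend to `0`, they vanish.
  have hiter : ∀ {x b : ι → ℝ → ℝ}, N.IsPeriodicState T x b → ∀ n : ℕ,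
      N.SameState x b (t + n * T) x b t := by
    intro x b hp n
    induction n with
    | zero => intro i; simp
    | succ n ih =>
      intro i
      have h1 := hp (t + n * T) (by positivity) i
      have h2 : t + (n + 1 : ℕ) * T = t + n * T + T := by push_cast; ring
      rw [h2]
      refine ⟨h1.1.trans (ih i).1, ?_⟩
      filter_upwards [h1.2, (ih i).2] with s hs hs' hst using (hs hst).trans (hs' hst)
  have htop : Tendsto (fun n : ℕ => t + n * T) atTop atTop :=
    tendsto_atTop_add_const_left _ t (tendsto_natCast_atTop_atTop.atTop_mul_const hT)
  intro i
  constructor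
  · have h1 := ((hconv i).1.comp htop).congr (f₂ := fun _ => |x i t - x' i t|) fun n => by
      simp only [Function.comp]
      rw [(hiter hp n i).1, (hiter hp' n i).1]
    exact sub_eq_zero.1 (abs_eq_zero.1 (tendsto_nhds_unique tendsto_const_nhds h1))
  · have h1 := ((hconv i).2.comp htop).congr
      (f₂ := fun _ => ∫ s in (-N.maxDelay)..0, |b i (t + s) - b' i (t + s)|) fun n => by
        refine intervalIntegral.integral_congr_ae ?_
        filter_upwards [(hiter hp n i).2, (hiter hp' n i).2] with s hs hs' hst
        rw [uIoc_of_le (by linarith)] at hst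
        rw [hs (Ioc_subset_Icc_self hst), hs' (Ioc_subset_Icc_self hst)]
    have h2 := tendsto_nhds_unique tendsto_const_nhds h1
    have hint : IntervalIntegrable (fun s => |b i (t + s) - b' i (t + s)|) volume
        (-N.maxDelay) 0 := by
      have h3 := ((h.intervalIntegrable i (u := t + -N.maxDelay) (v := t + 0) (by linarith)
        (by linarith)).sub (h'.intervalIntegrable i (u := t + -N.maxDelay) (v := t + 0)
        (by linarith) (by linarith))).abs.comp_add_left t
      simpa only [add_sub_cancel_left] using h3
    rw [intervalIntegral.integral_eq_zero_iff_of_le_of_nonneg_ae (by linarith)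
      (Eventually.of_forall fun _ => abs_nonneg _) hint, Filter.EventuallyEq,
      ae_restrict_iff' measurableSet_Ioc] at h2
    filter_upwards [h2, compl_mem_ae_iff.2 (measure_singleton (-N.maxDelay))] with s hs hne hst
    exact sub_eq_zero.1 (abs_eq_zero.1 (hs ⟨lt_of_le_of_ne hst.1 (Ne.symm hne), hst.2⟩))

end IsTrajectory

end QueueNetwork

theorem theorem4 {ι : Type*} [Fintype ι] [DecidableEq ι] (N : QueueNetwork ι)
    (T : ℝ) (hT : 0 < T) (e c : ι → ℝ → ℝ)
    (he_nonneg : ∀ i t, 0 ≤ e i t) (hc_nonneg : ∀ i t, 0 ≤ c i t)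
    (he_int : ∀ i, IntervalIntegrable (e i) volume 0 T)
    (hc_int : ∀ i, IntervalIntegrable (c i) volume 0 T)
    (he_per : ∀ i, Function.Periodic (e i) T) (hc_per : ∀ i, Function.Periodic (c i) T)
    (hstable : N.Stable T e c) :
    ∃ xs bs : ι → ℝ → ℝ,
      -- `(xs, bs)` is a trajectory and its state is periodic with period `T`
      N.IsTrajectory e c xs bs ∧ N.IsPeriodicState T xs bs ∧
      -- it is the only such trajectory
      (∀ x b : ι → ℝ → ℝ, N.IsTrajectory e c x b → N.IsPeriodicState T x b →
        ∀ t, 0 ≤ t → N.SameState x b t xs bs t) ∧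
      -- every trajectory converges to it
      (∀ x b : ι → ℝ → ℝ, N.IsTrajectory e c x b → N.ConvergesTo x b xs bs) := by
  have he : ∀ i u v, IntervalIntegrable (e i) volume u v := fun i =>
    (he_per i).intervalIntegrable₀ hT.ne' (he_int i)
  have hc : ∀ i u v, IntervalIntegrable (c i) volume u v := fun i =>
    (hc_per i).intervalIntegrable₀ hT.ne' (hc_int i)
  obtain ⟨x₀, b₀, h₀⟩ := N.exists_isTrajectory he_nonneg hc_nonneg he hc
  obtain ⟨xs, bs, hs, hsp⟩ :=
    h₀.exists_periodic he_nonneg hc_nonneg he hc hT he_per hc_per hstable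
  have hconv : ∀ x b : ι → ℝ → ℝ, N.IsTrajectory e c x b → N.ConvergesTo x b xs bs :=
    fun x b h => h.convergesTo hs he_nonneg hc_nonneg he hc hT he_per hc_per hstable
  exact ⟨xs, bs, hs, hsp, fun x b h hp t ht =>
    h.sameState_of_convergesTo hs hT hp hsp (hconv x b h) ht, hconv⟩
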